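/- Let $k$ be a field of characteristic zero, let $F=k((t))(x)$ be the function field of the projective $x$-line $\mathbb{P}^1_{k[[t]]}$, and let $q\in k[x]$ be an irreducible polynomial of degree $r$. Let $P$ be the closed point of the affine line $\mathbb{A}^1_k$ in the closed fibre $\mathbb{P}^1_k$ defined by $q$, let $U=\mathbb{P}^1_k\smallsetminus\{P\}$, and let $k'=k[x]/(q)$. Let $R_P$ be the local ring of $\mathbb{P}^1_{k[[t]]}$ at $P$, let $\widehat R_P$ be its completion and $F_P=\operatorname{Frac}\widehat R_P$; let $R_U\subset F$ be the ring of functions regular at all points of $U$, let $\widehat R_U$ be its $t$-adic completion and $F_U=\operatorname{Frac}\widehat R_U$; let $\widehat R_P^\circ$ be the completion of the localization of $\widehat R_P$ at $t\widehat R_P$ and $F_P^\circ=\operatorname{Frac}\widehat R_P^\circ$. Let $k[x]\hookrightarrow k'[[q]]$ be the $k$-linear ring embedding into the $(q)$-adic completion: it sends the polynomial $q(x)$ to the variable $q$, and $x$ to a power series whose constant coefficient is the class of $x$ in $k'$. The induced embedding of $F=k((t))(x)$ into the iterated Laurent series field $k'((q))((t))$ identifies $\widehat R_P=k'[[q,t]]$,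 $\widehat R_U=k[q^{-1},xq^{-1},\dots,x^{r-1}q^{-1}][[t]]$ and $\widehat R_P^\circ=k'((q))[[t]]$, and so identifies $F_P^\circ$ with $k'((q))((t))$ and $F$, $F_P$, $F_U$ with subfields of it. Let $a\in F^\times$, and let $\partial_a$ be the derivation of $F_P^\circ=k'((q))((t))$ given by $$\partial_a\Big(\sum_{j\ge n}\sum_{i\ge n_j}\alpha_{ij}q^it^j\Big)=a\cdot\sum_{j\ge n}\sum_{i\ge n_j} i\,\alpha_{ij}q^{i-1}t^j\qquad(\alpha_{ij}\in k').$$ Then $\partial_a$ restricts to derivations on $F_P$ and on $F_U$, and it restricts to the derivation $\beta\cdot\partial/\partial x$ on $F$, where $\beta=\left(\frac{\partial q}{\partial x}\right)^{-1}a$. With respect to these derivations, $(F,F_P,F_U,F_P^\circ)$ is a differential diamond with the factorization property. That is: $\operatorname{char} F=0$; $F\subseteq F_P,F_U\subseteq F_P^\circ$ with $F_P\cap F_U=F$; for every $n$, every $A\in\operatorname{GL}_n(F_P^\circ)$ can be written as $A=B\cdot C$ with $B\in\operatorname{GL}_n(F_U)$ and $C\in\operatorname{GL}_n(F_P)$;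 and the derivations on the four fields are compatible with the inclusions. -/

import Mathlib

open Polynomial

namespace DiffPatching

noncomputable section

/-! ### Derivations and diamonds -/

/-- Derivations (additive maps satisfying the Leibniz rule) from a ring to itself. -/
abbrev SelfDerivation (R : Type*) [CommRing R] := Derivation ℤ R R

/-- The derivation given by an additive map satisfying the Leibniz rule. -/
def SelfDerivation.ofAddMonoidHom {R : Type*} [CommRing R] (D : R →+ R)
    (h : ∀ f g, D (f * g) = f * D g + g * D f) : SelfDerivation R :=
  Derivation.mk' D.toIntLinearMap h

/-- `(F, F₁, F₂, F₀)`, with `F`, `F₁`, `F₂` given as subfields of `F₀`, is a diamond with the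
factorization property. -/
structure IsDiamond {F₀ : Type*} [Field F₀] (F F₁ F₂ : Subfield F₀) : Prop where
  le_left : F ≤ F₁
  le_right : F ≤ F₂
  inf_eq : F₁ ⊓ F₂ = F
  factorization : ∀ (n : ℕ) (A : GL (Fin n) F₀),
    ∃ (B : GL (Fin n) F₂) (C : GL (Fin n) F₁),
      A = Matrix.GeneralLinearGroup.map F₂.subtype B * Matrix.GeneralLinearGroup.map F₁.subtype C

/-- `(F, F₁, F₂, F₀)` is a differential diamond with the factorization property, with respect to
the derivations `d`, `d₁`, `d₂`, `d₀` on `F`, `F₁`, `F₂`, `F₀`. -/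
structure IsDifferentialDiamond {F₀ : Type*} [Field F₀] (F F₁ F₂ : Subfield F₀)
    (d : SelfDerivation F) (d₁ : SelfDerivation F₁) (d₂ : SelfDerivation F₂)
    (d₀ : SelfDerivation F₀) : Prop extends IsDiamond F F₁ F₂ where
  charZero : CharZero F
  compat_left : ∀ f : F, d₁ (Subfield.inclusion le_left f) = Subfield.inclusion le_left (d f)
  compat_right : ∀ f : F, d₂ (Subfield.inclusion le_right f) = Subfield.inclusion le_right (d f)
  compat₁ : ∀ f : F₁, d₀ f = d₁ f
  compat₂ : ∀ f : F₂, d₀ f = d₂ f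

/-! ### Localizations, completions, fraction fields -/

/-- The fraction field, inside a field `L`, of a subring of `L`. -/
def fractionField {L : Type*} [Field L] (S : Subring L) : Subfield L := Subfield.closure S

/-- The localization at the prime ideal `𝔪` of a domain `A` that is embedded into a field `L` by
`φ`, as a subring of `L`. -/
def localizationIn {A L : Type*} [CommRing A] [Field L] (φ : A →+* L) (𝔪 : Ideal A) [𝔪.IsPrime] :
    Subring L where
  carrier := {z | ∃ f g : A, g ∉ 𝔪 ∧ φ g ≠ 0 ∧ z = φ f / φ g}
  zero_mem' := ⟨0, 1, 𝔪.one_notMem, by simp, by simp⟩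
  one_mem' := ⟨1, 1, 𝔪.one_notMem, by simp, by simp⟩
  add_mem' := by
    rintro _ _ ⟨f, g, hg, hg', rfl⟩ ⟨f₁, g₁, hg₁, hg₁', rfl⟩
    refine ⟨f * g₁ + g * f₁, g * g₁, ?_, ?_, ?_⟩
    · exact fun h => (Ideal.IsPrime.mem_or_mem ‹_› h).elim hg hg₁
    · simp [hg', hg₁']
    · simp [div_add_div _ _ hg' hg₁']
  mul_mem' := by
    rintro _ _ ⟨f, g, hg, hg', rfl⟩ ⟨f₁, g₁, hg₁, hg₁', rfl⟩
    refine ⟨f * f₁, g * g₁, ?_, ?_, ?_⟩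
    · exact fun h => (Ideal.IsPrime.mem_or_mem ‹_› h).elim hg hg₁
    · simp [hg', hg₁']
    · simp [div_mul_div_comm]
  neg_mem' := by
    rintro _ ⟨f, g, hg, hg', rfl⟩
    exact ⟨-f, g, hg, hg', by simp [neg_div]⟩

theorem mem_localizationIn {A L : Type*} [CommRing A] [Field L] (φ : A →+* L) (𝔪 : Ideal A)
    [𝔪.IsPrime] (f : A) : φ f ∈ localizationIn φ 𝔪 :=
  ⟨f, 1, 𝔪.one_notMem, by simp, by simp⟩

/-- The maximal ideal `𝔪 A_𝔪` of the localization `A_𝔪`. -/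
def localizationIdeal {A L : Type*} [CommRing A] [Field L] (φ : A →+* L) (𝔪 : Ideal A)
    [𝔪.IsPrime] : Ideal (localizationIn φ 𝔪) :=
  𝔪.map (φ.codRestrict (localizationIn φ 𝔪) (mem_localizationIn φ 𝔪))

/-- The ring `S`, together with the homomorphism `φ` from `R` to it, is the `I`-adic completion of
the ring `R`. Here `S` is given as a subring of `L`, and the values of `φ` lie in `S`. -/
def IsCompletionIn {R L : Type*} [CommRing R] [CommRing L] (I : Ideal R) (φ : R →+* L)
    (S : Subring L) : Prop :=
  ∃ e : AdicCompletion I R ≃+* S, ∀ r : R, (e (algebraMap R (AdicCompletion I R) r) : L) = φ r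

/-! ### The projective line over `k⟦t⟧` -/

section ProjectiveLine

variable (k : Type*) [Field k]

/-- The function field `k((t))(x)` of the projective `x`-line over `k⟦t⟧`. -/
abbrev FunctionField := RatFunc (LaurentSeries k)

/-- The inclusion of the field of constants `k((t))` into `k((t))(x)`. -/
abbrev constants : LaurentSeries k →+* FunctionField k := RatFunc.C

variable {k}

/-- The derivation `∂/∂x` of `k((t))(x)`, by the quotient rule. -/
def ddx (f : FunctionField k) : FunctionField k :=
  algebraMap (LaurentSeries k)[X] (FunctionField k)
      (derivative f.num * f.denom - f.num * derivative f.denom) /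
    algebraMap (LaurentSeries k)[X] (FunctionField k) (f.denom ^ 2)

/-- A polynomial `q = q(x)` over `k`, as an element of `k((t))(x)`. -/
def ofPoly (q : k[X]) : FunctionField k :=
  algebraMap (LaurentSeries k)[X] (FunctionField k) (q.map HahnSeries.C)

/-- The coordinate ring `k⟦t⟧[u]` of the affine line over `k⟦t⟧` with coordinate `u ∈ k((t))(x)`,
mapped to `k((t))(x)`. The projective line is covered by the charts `u = x` and `u = x⁻¹`. -/
def chart (u : FunctionField k) : (PowerSeries k)[X] →+* FunctionField k :=
  eval₂RingHom ((constants k).comp (HahnSeries.ofPowerSeries ℤ k)) u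

/-- The prime ideal of `k⟦t⟧[u]` that corresponds to the point of the closed fibre `t = 0` which is
given by the prime ideal `𝔭` of `k[u]`. -/
def fibrePrime (𝔭 : Ideal k[X]) : Ideal (PowerSeries k)[X] :=
  𝔭.comap (mapRingHom PowerSeries.constantCoeff)

instance (𝔭 : Ideal k[X]) [𝔭.IsPrime] : (fibrePrime 𝔭).IsPrime :=
  Ideal.comap_isPrime _ _

instance (q : k[X]) [h : Fact (Irreducible q)] : (Ideal.span {q}).IsPrime :=
  (Ideal.span_singleton_prime h.out.ne_zero).2 h.out.prime

instance : Fact (Irreducible (X : k[X])) := ⟨irreducible_X⟩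

/-- The ring `R_U ⊆ k((t))(x)` of functions that are regular at all points of `U`, where `U` is the
complement, in the closed fibre, of the point `q = 0`. The points of `U` are those points of the
affine `x`-line over `k` (prime ideals of `k[x]`) that are different from `(q)`, and the point at
infinity, which is the origin of the affine line with coordinate `x⁻¹`. -/
def ringU (q : k[X]) : Subring (FunctionField k) :=
  (⨅ (𝔭 : Ideal k[X]) (_ : 𝔭.IsPrime) (_ : 𝔭 ≠ Ideal.span {q}),
      localizationIn (chart RatFunc.X) (fibrePrime 𝔭)) ⊓
    localizationIn (chart RatFunc.X⁻¹) (fibrePrime (Ideal.span {(X : k[X])}))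

theorem chart_C (u : FunctionField k) (c : PowerSeries k) :
    chart u (C c) = constants k (HahnSeries.ofPowerSeries ℤ k c) := by
  simp [chart]

/-- The uniformizer `t` as an element of `R_U`. -/
def ringUt (q : k[X]) : ringU q :=
  ⟨constants k (HahnSeries.ofPowerSeries ℤ k PowerSeries.X), by
    refine Subring.mem_inf.2 ⟨?_, ?_⟩
    · simp only [Subring.mem_iInf]
      intro 𝔭 _ _
      rw [← chart_C RatFunc.X]
      exact mem_localizationIn _ _ _
    · rw [← chart_C RatFunc.X⁻¹]
      exact mem_localizationIn _ _ _⟩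

end ProjectiveLine

/-! ### The derivations `∂_a` on iterated Laurent series -/

section Derivations

variable {K : Type*} [Field K]

theorem coeff_mul_smul_of_coeff {Γ : Type*} [AddCommGroup Γ] [PartialOrder Γ]
    [IsOrderedCancelAddMonoid Γ] {R : Type*} [CommRing R] (D : Γ → R → R)
    (hD : ∀ i, D i 0 = 0) (hDs : ∀ i (s : Finset (Γ × Γ)) (F : Γ × Γ → R),
      D i (∑ x ∈ s, F x) = ∑ x ∈ s, D i (F x))
    (hDm : ∀ i j x y, D (i + j) (x * y) = x * D j y + y * D i x)
    (f g f' g' : HahnSeries Γ R) (hf : ∀ i, f'.coeff i = D i (f.coeff i))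
    (hg : ∀ i, g'.coeff i = D i (g.coeff i)) (n : Γ) :
    D n ((f * g).coeff n) = (f * g' + g * f').coeff n := by
  have hf' : f'.support ⊆ f.support := by
    intro i hi h
    exact hi (by rw [hf, h, hD])
  have hg' : g'.support ⊆ g.support := by
    intro i hi h
    exact hi (by rw [hg, h, hD])
  rw [HahnSeries.coeff_add, mul_comm g f', HahnSeries.coeff_mul,
    HahnSeries.coeff_mul_right' g.isPWO_support hg',
    HahnSeries.coeff_mul_left' f.isPWO_support hf', hDs, ← Finset.sum_add_distrib]
  refine Finset.sum_congr rfl fun x hx => ?_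
  rw [Finset.mem_antidiagonal] at hx
  rw [← hx.2.2, hDm, hf, hg, mul_comm (D x.1 _)]

theorem laurent_leibniz (f g : LaurentSeries K) :
    LaurentSeries.derivative K (f * g) =
      f * LaurentSeries.derivative K g + g * LaurentSeries.derivative K f := by
  have key : ∀ f : LaurentSeries K, ∀ i,
      (HahnSeries.single (1 : ℤ) (1 : K) * LaurentSeries.derivative K f).coeff i =
        (i : K) * f.coeff i := by
    intro f i
    have := HahnSeries.coeff_single_mul_add (r := (1 : K))
      (x := LaurentSeries.derivative K f) (a := i - 1) (b := (1 : ℤ))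
    rw [sub_add_cancel] at this
    rw [this, LaurentSeries.derivative_apply, LaurentSeries.hasseDeriv_coeff]
    simp
  have h1 : HahnSeries.single (1 : ℤ) (1 : K) ≠ 0 := by simp
  apply mul_left_cancel₀ h1
  ext n
  rw [key, mul_add, mul_left_comm _ f, mul_left_comm _ g]
  exact coeff_mul_smul_of_coeff (fun (i : ℤ) x => (i : K) * x) (by simp)
    (fun i s F => Finset.mul_sum _ _ _) (fun i j x y => by push_cast; ring) f g _ _
    (key f) (key g) n

/-- The additive map `∂_a` on `k((w))((t))`: the coefficients (with respect to `t`), which are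
Laurent series in `w`, are differentiated with respect to `w`, and the result is multiplied by `a`. -/
def partialAddHom (a : LaurentSeries (LaurentSeries K)) :
    LaurentSeries (LaurentSeries K) →+ LaurentSeries (LaurentSeries K) where
  toFun f := a * f.map (LaurentSeries.derivative K)
  map_zero' := by
    rw [show (0 : LaurentSeries (LaurentSeries K)).map (LaurentSeries.derivative K) = 0 from by
      ext; simp, mul_zero]
  map_add' f g := by
    rw [← mul_add]
    congr 1
    ext; simp

/-- The derivation `∂_a` on `k((w))((t))`. -/
def partialDeriv (a : LaurentSeries (LaurentSeries K)) :
    SelfDerivation (LaurentSeries (LaurentSeries K)) :=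
  SelfDerivation.ofAddMonoidHom (partialAddHom a) (by
    intro f g
    have : (f * g).map (LaurentSeries.derivative K) =
        f * g.map (LaurentSeries.derivative K) + g * f.map (LaurentSeries.derivative K) := by
      ext1
      funext n
      exact coeff_mul_smul_of_coeff
        (D := fun (_ : ℤ) (x : LaurentSeries K) => LaurentSeries.derivative K x)
        (fun _ => map_zero _) (fun _ s F => map_sum (LaurentSeries.derivative K) F s)
        (fun _ _ x y => laurent_leibniz x y) f g (f.map (LaurentSeries.derivative K))
        (g.map (LaurentSeries.derivative K))
        (HahnSeries.map_coeff _ _) (HahnSeries.map_coeff _ _) n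
    change a * (f * g).map (LaurentSeries.derivative K) =
      f * (a * g.map (LaurentSeries.derivative K)) + g * (a * f.map (LaurentSeries.derivative K))
    rw [this]
    ring)

end Derivations

/-! ### The fields `F_P`, `F_U`, `F_P°` -/

section Fields

variable {k : Type*} [Field k] (q : k[X]) [Fact (Irreducible q)]

/-- The residue field `k' = k[x]/(q)`. -/
abbrev ResField := AdjoinRoot q

/-- The field `F_P° = k'((q))((t))`, with the inner variable `w` standing for `q`. -/
abbrev FPcirc := LaurentSeries (LaurentSeries (ResField q))

/-- The image of `x` under the embedding of `k[x]` into its `(q)`-adic completion `k'⟦q⟧` exists and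
is unique: it is a solution `ξ` of `q(ξ) = w` with the residue class of `x` as constant
coefficient. -/
theorem existsUnique_xi [CharZero k] : ∃! ξ : PowerSeries (ResField q),
    eval₂ (PowerSeries.C.comp (AdjoinRoot.of q)) ξ q = PowerSeries.X ∧
      PowerSeries.constantCoeff ξ = AdjoinRoot.root q := by
  have hq : Irreducible q := Fact.out
  have hdeg : 0 < q.natDegree := hq.natDegree_pos
  have hlc : q.leadingCoeff ≠ 0 := leadingCoeff_ne_zero.2 hq.ne_zero
  set φ : k →+* PowerSeries (ResField q) := PowerSeries.C.comp (AdjoinRoot.of q) with hφ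
  have hcφ : (PowerSeries.constantCoeff).comp φ = AdjoinRoot.of q := by
    ext; simp [hφ]
  -- a unit multiple of the polynomial whose root is wanted
  set p : k[X] := C q.leadingCoeff⁻¹ * q with hp
  have hpm : p.Monic := by
    rw [hp, mul_comm]; exact monic_mul_leadingCoeff_inv hq.ne_zero
  have hpd : 0 < p.natDegree := by
    rw [hp, natDegree_C_mul (inv_ne_zero hlc)]; exact hdeg
  set f : (PowerSeries (ResField q))[X] :=
    p.map φ - C (φ q.leadingCoeff⁻¹ * PowerSeries.X) with hf
  have hfm : f.Monic := by
    refine (hpm.map φ).sub_of_left ?_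
    refine lt_of_le_of_lt degree_C_le ?_
    rw [hpm.degree_map]
    exact natDegree_pos_iff_degree_pos.1 hpd
  have hroot : ∀ ξ, f.eval ξ = 0 ↔ eval₂ φ ξ q = PowerSeries.X := by
    intro ξ
    have hu : φ q.leadingCoeff⁻¹ ≠ 0 := by
      rw [Ne, map_eq_zero]; exact inv_ne_zero hlc
    rw [hf, eval_sub, eval_C, eval_map, hp, eval₂_mul, eval₂_C, ← mul_sub, mul_eq_zero,
      sub_eq_zero]
    simp [hu]
  have hsep : aeval (AdjoinRoot.root q) (derivative q) ≠ 0 :=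
    hq.separable.aeval_derivative_ne_zero (by simp)
  have hder : ∀ ξ, PowerSeries.constantCoeff ξ = AdjoinRoot.root q →
      IsUnit (f.derivative.eval ξ) := by
    intro ξ hξ
    rw [PowerSeries.isUnit_iff_constantCoeff, isUnit_iff_ne_zero, hf, derivative_sub,
      derivative_C, sub_zero, derivative_map, eval_map, hom_eval₂, hcφ, hξ, hp,
      derivative_C_mul, eval₂_mul, eval₂_C]
    refine mul_ne_zero ?_ hsep
    rw [Ne, map_eq_zero]; exact inv_ne_zero hlc
  obtain ⟨ξ, hξ, hξ'⟩ := HenselianRing.is_henselian (I := Ideal.span {PowerSeries.X}) f hfm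
    (PowerSeries.C (AdjoinRoot.root q)) (by
      rw [Ideal.mem_span_singleton, PowerSeries.X_dvd_iff, hf, eval_sub, eval_C, eval_map,
        map_sub, hom_eval₂, hcφ, hp]
      simp [eval₂_mul]) ((hder _ (by simp)).map _)
  rw [Ideal.mem_span_singleton, PowerSeries.X_dvd_iff, map_sub, sub_eq_zero,
    PowerSeries.constantCoeff_C] at hξ'
  refine ⟨ξ, ⟨(hroot ξ).1 hξ, hξ'⟩, ?_⟩
  rintro η ⟨hη, hη'⟩
  have hη := (hroot η).2 hη
  obtain ⟨c, hc⟩ := f.binomExpansion ξ (η - ξ)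
  rw [add_sub_cancel, hη, show f.eval ξ = 0 from hξ] at hc
  have h0 : (f.derivative.eval ξ + c * (η - ξ)) * (η - ξ) = 0 := by
    linear_combination -hc
  rcases mul_eq_zero.1 h0 with h | h
  · exfalso
    have h2 := hder ξ hξ'
    rw [PowerSeries.isUnit_iff_constantCoeff, isUnit_iff_ne_zero] at h2
    apply h2
    have := congrArg PowerSeries.constantCoeff h
    simpa [hη', hξ'] using this
  · exact sub_eq_zero.1 h

variable [CharZero k]

/-- The image of `x` in the `(q)`-adic completion `k'⟦q⟧` of `k[x]`. -/
def xi : PowerSeries (ResField q) := (existsUnique_xi q).choose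

/-- The image of `x` in `k'((q))`. -/
def xiL : LaurentSeries (ResField q) := HahnSeries.ofPowerSeries ℤ _ (xi q)

/-- The inclusion of `k` into `k'((q))`. -/
def baseHom : k →+* LaurentSeries (ResField q) := HahnSeries.C.comp (AdjoinRoot.of q)

/-- Apply a ring homomorphism to the coefficients of Laurent series. -/
def mapLaurent {R S : Type*} [Ring R] [Ring S] (φ : R →+* S) :
    LaurentSeries R →+* LaurentSeries S where
  toFun f := f.map φ
  map_zero' := by ext; simp
  map_one' := HahnSeries.map_one φ.toMonoidWithZeroHom
  map_add' f g := by ext; simp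
  map_mul' f g := HahnSeries.map_mul (φ : R →ₙ+* S)

instance {R : Type*} [CommRing R] [IsDomain R] :
    (Ideal.span {(PowerSeries.X : PowerSeries R)}).IsPrime :=
  PowerSeries.span_X_isPrime

/-- The embedding of `k((t))[x]` into `k'((q))((t))`. -/
def embedPoly : (LaurentSeries k)[X] →+* FPcirc q :=
  eval₂RingHom (mapLaurent (baseHom q)) (HahnSeries.C (xiL q))

theorem eval_xi_ne_zero {p : k[X]} (hp : p ≠ 0) : eval₂ (baseHom q) (xiL q) p ≠ 0 := by
  have hq : Irreducible q := Fact.out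
  obtain ⟨h1, h2⟩ := (existsUnique_xi q).choose_spec.1
  obtain ⟨n, r, hr, rfl⟩ := WfDvdMonoid.max_power_factor hp hq
  have hL : ∀ s : k[X], eval₂ (baseHom q) (xiL q) s =
      HahnSeries.ofPowerSeries ℤ _ (eval₂ (PowerSeries.C.comp (AdjoinRoot.of q)) (xi q) s) := by
    intro s
    rw [hom_eval₂]
    congr 1
    ext; simp [baseHom]
  rw [hL, Ne, map_eq_zero_iff _ HahnSeries.ofPowerSeries_injective, eval₂_mul, eval₂_pow]
  refine mul_ne_zero (pow_ne_zero _ ?_) fun h => hr ?_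
  · rw [xi, h1]; exact PowerSeries.X_ne_zero
  · have := congrArg PowerSeries.constantCoeff h
    rw [hom_eval₂, map_zero, xi, h2, ← RingHom.comp_assoc] at this
    rw [← AdjoinRoot.mk_eq_zero, ← AdjoinRoot.aeval_eq, aeval_def, ← this]
    congr 1

theorem embedPoly_injective : Function.Injective (embedPoly q) := by
  rw [injective_iff_map_eq_zero]
  intro f hf
  by_contra hne
  obtain ⟨i, hi⟩ : ∃ i, f.coeff i ≠ 0 := by
    by_contra! h
    exact hne (Polynomial.ext h)
  obtain ⟨n, hn⟩ : ∃ n, (f.coeff i).coeff n ≠ 0 := by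
    by_contra! h
    exact hi (HahnSeries.ext (funext h))
  set g : k[X] := ∑ j ∈ f.support, monomial j ((f.coeff j).coeff n) with hg
  have hgc : g.coeff i = (f.coeff i).coeff n := by
    rw [hg, finsetSum_coeff]
    simp only [coeff_monomial]
    rw [Finset.sum_ite_eq' f.support i, if_pos (mem_support_iff.2 hi)]
  refine eval_xi_ne_zero q (p := g) (fun h => hn (by rw [← hgc, h, coeff_zero])) ?_
  have := congrArg (fun z : FPcirc q => z.coeff n) hf
  simp only [embedPoly, coe_eval₂RingHom, eval₂_eq_sum, Polynomial.sum, HahnSeries.coeff_sum,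
    HahnSeries.coeff_zero, ← map_pow] at this
  rw [hg, eval₂_finsetSum, ← this]
  refine Finset.sum_congr rfl fun j _ => ?_
  rw [eval₂_monomial, mul_comm (mapLaurent _ _), HahnSeries.C_mul_eq_smul,
    HahnSeries.coeff_smul, smul_eq_mul, mul_comm]
  rfl

/-- The embedding of `F = k((t))(x)` into `F_P° = k'((q))((t))`. -/
def embed : FunctionField k →+* FPcirc q :=
  RatFunc.liftRingHom (embedPoly q)
    (nonZeroDivisors_le_comap_nonZeroDivisors_of_injective _ (embedPoly_injective q))

/-- `F` as a subfield of `F_P°`. -/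
def fieldF : Subfield (FPcirc q) := (embed q).fieldRange

/-- The inclusion of `k'⟦q, t⟧ = k'⟦q⟧⟦t⟧` into `k'((q))((t))`. -/
def doubleSeries : PowerSeries (PowerSeries (ResField q)) →+* FPcirc q :=
  (HahnSeries.ofPowerSeries ℤ (LaurentSeries (ResField q))).comp
    (PowerSeries.map (HahnSeries.ofPowerSeries ℤ (ResField q)))

/-- The ring `R̂_P = k'⟦q, t⟧`. -/
def ringPhat : Subring (FPcirc q) := (doubleSeries q).range

/-- The coordinate ring `k[q⁻¹, xq⁻¹, …, xʳ⁻¹q⁻¹]`, `r = deg q`, of `U`, as a subring of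
`k'((q))`. -/
def coordRingU : Subring (LaurentSeries (ResField q)) :=
  Subring.closure (Set.range (baseHom q) ∪
    {z | ∃ i < q.natDegree, z = xiL q ^ i * (HahnSeries.single (1 : ℤ) 1)⁻¹})

/-- The ring `R̂_U = k[q⁻¹, xq⁻¹, …, xʳ⁻¹q⁻¹]⟦t⟧`. -/
def ringUhat : Subring (FPcirc q) :=
  ((HahnSeries.ofPowerSeries ℤ (LaurentSeries (ResField q))).comp
    (PowerSeries.map (coordRingU q).subtype)).range

/-- The ring `R̂_P° = k'((q))⟦t⟧`. -/
def ringPcirc : Subring (FPcirc q) :=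
  (HahnSeries.ofPowerSeries ℤ (LaurentSeries (ResField q))).range

/-- The field `F_P = k'((q, t)) = Frac k'⟦q, t⟧`. -/
def fieldP : Subfield (FPcirc q) := fractionField (ringPhat q)

/-- The field `F_U = Frac (k[q⁻¹, xq⁻¹, …, xʳ⁻¹q⁻¹]⟦t⟧)`. -/
def fieldU : Subfield (FPcirc q) := fractionField (ringUhat q)

end Fields

end

end DiffPatching

namespace DiffPatching

noncomputable section

/-! ### A criterion for being the completion -/

/-! Write `w` for the variable of `k'((q))`, `O = k'[[q]]` for `integers q`, and `A` for `coordRingU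
q`. Put `r = deg q`. The geometry rests on one description of `A`: it consists of the fractions `f /
q ^ m` with `deg f ≤ r * m`, because such a fraction has a pole at most at `P` and the degree bound
is regularity at infinity (`evalXiL_div_unif_mem`, `exists_evalXiL_of_mem`). Two facts follow.
First, `k'((q)) = A + O`, the vanishing of `H¹` of the structure sheaf of the projective line
(`exists_add_of_coordRingU_integers`). Second, `q ^ n A ∩ O` consists of polynomials of degree at
most `r * n` (`exists_evalXiL_of_mem_integers`).

Completions. A ring is the completion if it is complete and separated for a filtration that induces
the powers of `I` on a dense image of `R` (`isCompletionIn_of_filtration`). For `R_U` and for the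
localization at `(t)` the filtration is by powers of `t`, and only the reduction modulo `t` has to
be known. For `R_P` it is the filtration of `k'[[q,t]]` by total degree.

Derivations. Differentiating `q(ξ) = w` gives `q'(ξ) ξ' = 1`, so `∂/∂q` is `(q')⁻¹ ∂/∂x` on `F`. It
preserves `O`, while `q' ∂/∂q` preserves `A`. Since `a` and `q'` lie in `F`, the derivation `∂_a`
preserves all three fraction fields.

Factorization. Truncating the inverse of a matrix in `t` gives a factor over `F_P` that reduces the
problem to a matrix congruent to `1` modulo `t`. Such a matrix is factored one power of `t` at a
time, each coefficient being split by `k'((q)) = A + O`.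

Intersection. Nonzero quotients of `O` and of `A` by principal ideals `(g₀)`, `g₀ ≠ 0`, are
finite-dimensional over `k`. This replaces Weierstrass preparation: up to a power of `t`, every
element of `F_P` has a denominator polynomial in `q` over `k[[t]]`, and every element of `F_U` one
polynomial in `q⁻¹` (`exists_mul_seriesEval_eq`). Over a common denominator the numerator of an
element of both fields has coefficients in `q ^ N A ∩ O` for one fixed `N`. These are polynomials in
`x` of bounded degree, so the numerator lies in `k[[t]][x]`. -/

theorem exists_ringHom_lift {R T M : Type*} [CommRing R] [CommRing T] [CommRing M]
    (φ : R →+* M) (j : T →+* M) (hj : Function.Injective j) (hφ : ∀ r, ∃ s, j s = φ r) :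
    ∃ ψ : R →+* T, ∀ r, j (ψ r) = φ r := by
  let jr : T ≃+* j.range := RingEquiv.ofBijective j.rangeRestrict
    ⟨fun x y h => hj (congrArg Subtype.val h), j.rangeRestrict_surjective⟩
  refine ⟨(jr.symm : j.range →+* T).comp (φ.codRestrict j.range hφ), fun r => ?_⟩
  exact congrArg Subtype.val (jr.apply_symm_apply (φ.codRestrict j.range hφ r))

/-- The last two hypotheses make each `R / I ^ n → T / J n` bijective, and `T` is the inverse limit
of the `T / J n` by separatedness and completeness. The filtration need not consist of powers of one
ideal, which allows the total-degree filtration later. -/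
theorem isCompletionIn_of_filtration {R T M : Type*} [CommRing R] [CommRing T] [CommRing M]
    (I : Ideal R) (φ : R →+* M) (j : T →+* M) (hj : Function.Injective j) (J : ℕ → Ideal T)
    (hJ : ∀ n, J (n + 1) ≤ J n) (h0 : ∀ s, (∀ n, s ∈ J n) → s = 0)
    (hc : ∀ s : ℕ → T, (∀ n, s (n + 1) - s n ∈ J n) → ∃ l, ∀ n, l - s n ∈ J n)
    (hφ : ∀ r, ∃ s, j s = φ r)
    (hI : ∀ n r s, j s = φ r → (s ∈ J n ↔ r ∈ I ^ n))
    (hd : ∀ n s, ∃ r s', j s' = φ r ∧ s - s' ∈ J n) :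
    IsCompletionIn I φ j.range := by
  obtain ⟨ψ, hψ⟩ := exists_ringHom_lift φ j hj hφ
  have hI' : ∀ n r, ψ r ∈ J n ↔ r ∈ I ^ n := fun n r => hI n r _ (hψ r)
  have hd' : ∀ n s, ∃ r, s - ψ r ∈ J n := by
    intro n s
    obtain ⟨r, s', h1, h2⟩ := hd n s
    refine ⟨r, ?_⟩
    rwa [← hj (h1.trans (hψ r).symm)]
  let q (n : ℕ) : R ⧸ I ^ n →+* T ⧸ J n :=
    Ideal.quotientMap (J n) ψ (fun r hr => (hI' n r).2 hr)
  have hq : ∀ n, Function.Bijective (q n) := by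
    intro n
    refine ⟨Ideal.quotientMap_injective' (fun r hr => (hI' n r).1 hr), fun y => ?_⟩
    obtain ⟨s, rfl⟩ := Ideal.Quotient.mk_surjective y
    obtain ⟨r, hr⟩ := hd' n s
    refine ⟨Ideal.Quotient.mk _ r, ?_⟩
    exact (Ideal.Quotient.eq.2 hr).symm
  let f (n : ℕ) : T →+* R ⧸ I ^ n :=
    ((RingEquiv.ofBijective (q n) (hq n)).symm : T ⧸ J n →+* R ⧸ I ^ n).comp
      (Ideal.Quotient.mk (J n))
  have hf : ∀ n s r, f n s = Ideal.Quotient.mk _ r ↔ s - ψ r ∈ J n := by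
    intro n s r
    rw [← Ideal.Quotient.eq]
    change (RingEquiv.ofBijective (q n) (hq n)).symm _ = _ ↔ _
    rw [RingEquiv.symm_apply_eq]
    rfl
  let E : T →+* AdicCompletion I R := AdicCompletion.liftRingHom I f (by
    intro m n hmn
    ext s
    obtain ⟨r, hr⟩ := hd' n s
    have h1 := (hf n s r).2 hr
    have h2 := (hf m s r).2 (antitone_nat_of_succ_le hJ hmn hr)
    rw [RingHom.comp_apply, h1, h2]
    rfl)
  have hE : ∀ n s, AdicCompletion.evalₐ I n (E s) = f n s :=
    fun n s => AdicCompletion.evalₐ_liftRingHom _ _ _ n s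
  have hbij : Function.Bijective E := by
    constructor
    · rw [injective_iff_map_eq_zero]
      intro s hs
      refine h0 s fun n => ?_
      have := hE n s
      rw [hs, map_zero, eq_comm, ← map_zero (Ideal.Quotient.mk (I ^ n)), hf, map_zero,
        sub_zero] at this
      exact this
    · intro x
      -- Representatives of the components of `x` form a Cauchy sequence; the limit of their images
      -- in `T` is the preimage of `x`.
      choose r hr using fun n => Ideal.Quotient.mk_surjective (AdicCompletion.evalₐ I n x)
      obtain ⟨l, hl⟩ := hc (fun n => ψ (r n)) (by
        intro n
        rw [← map_sub, hI', ← Ideal.Quotient.eq, hr n]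
        obtain ⟨c, rfl⟩ := AdicCompletion.mk_surjective I R x
        rw [AdicCompletion.evalₐ_mk, Ideal.Quotient.eq]
        have h1 := hr (n + 1)
        rw [AdicCompletion.evalₐ_mk, Ideal.Quotient.eq] at h1
        have h2 := Ideal.Quotient.eq.1 (AdicCompletion.Ideal.mk_eq_mk (I := I) n.le_succ c)
        have := add_mem (Ideal.pow_le_pow_right n.le_succ h1) h2
        simpa using this)
      refine ⟨l, AdicCompletion.ext_evalₐ fun n => ?_⟩
      rw [hE, ← hr, hf]
      exact hl n
  have hrange : Function.Bijective j.rangeRestrict :=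
    ⟨fun x y h => hj (congrArg Subtype.val h), j.rangeRestrict_surjective⟩
  refine ⟨(RingEquiv.ofBijective E hbij).symm.trans (RingEquiv.ofBijective _ hrange), fun r => ?_⟩
  have h1 : (RingEquiv.ofBijective E hbij).symm (algebraMap R (AdicCompletion I R) r) = ψ r := by
    rw [RingEquiv.symm_apply_eq]
    refine AdicCompletion.ext_evalₐ fun n => ?_
    change _ = AdicCompletion.evalₐ I n (E (ψ r))
    rw [hE, (hf n (ψ r) r).2 (by simp)]
    simp
  rw [RingEquiv.trans_apply, h1]
  exact hψ r

/-! ### Power series with coefficients in a subring -/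

section SeriesOver

variable {L : Type*} [Field L]

/-- The inclusion of `S⟦t⟧` into `L((t))`, for a subring `S` of `L`. -/
def seriesHom (S : Subring L) : PowerSeries S →+* LaurentSeries L :=
  (HahnSeries.ofPowerSeries ℤ L).comp (PowerSeries.map S.subtype)

theorem seriesHom_injective (S : Subring L) : Function.Injective (seriesHom S) := by
  intro f g h
  have h1 := HahnSeries.ofPowerSeries_injective (Γ := ℤ) (R := L) h
  ext n
  simpa using congrArg (PowerSeries.coeff n) h1

theorem mem_range_seriesHom {S : Subring L} {z : LaurentSeries L} :
    z ∈ (seriesHom S).range ↔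
      ∃ f : PowerSeries L, (∀ n, PowerSeries.coeff n f ∈ S) ∧ HahnSeries.ofPowerSeries ℤ L f = z := by
  constructor
  · rintro ⟨g, rfl⟩
    exact ⟨PowerSeries.map S.subtype g, fun n => by simp, rfl⟩
  · rintro ⟨f, hf, rfl⟩
    refine ⟨PowerSeries.mk fun n => ⟨PowerSeries.coeff n f, hf n⟩, ?_⟩
    rw [seriesHom, RingHom.comp_apply]
    congr 1
    ext n
    simp

theorem powerSeries_eq_C_add_X_mul {R : Type*} [CommRing R] (f : PowerSeries R) :
    ∃ g, f = PowerSeries.C (PowerSeries.constantCoeff f) + PowerSeries.X * g := by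
  obtain ⟨g, hg⟩ := PowerSeries.X_dvd_iff.2
    (show PowerSeries.constantCoeff (f - PowerSeries.C (PowerSeries.constantCoeff f)) = 0 by simp)
  exact ⟨g, by rw [← hg]; ring⟩

/-- Only the reduction modulo `t` matters: its values are exactly `S`, each one lifted by an element
mapping to a constant, and its kernel is `t R`. Subtracting a constant and dividing by `t`,
repeatedly, then controls every coefficient. This serves both for `R_U` and for the localization at
`(t)`. -/
theorem isCompletionIn_seriesHom {R : Type*} [CommRing R] (t : R) (φ : R →+* LaurentSeries L)
    (S : Subring L) (ht : φ t = HahnSeries.ofPowerSeries ℤ L PowerSeries.X)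
    (h1 : ∀ r, ∃ F : PowerSeries L, φ r = HahnSeries.ofPowerSeries ℤ L F ∧
      PowerSeries.constantCoeff F ∈ S)
    (h2 : ∀ c ∈ S, ∃ r, φ r = HahnSeries.C c)
    (h3 : ∀ r, ∀ F : PowerSeries L, φ r = HahnSeries.ofPowerSeries ℤ L F →
      PowerSeries.constantCoeff F = 0 → ∃ r', r = t * r') :
    IsCompletionIn (Ideal.span {t}) φ (seriesHom S).range := by
  have hι := HahnSeries.ofPowerSeries_injective (Γ := ℤ) (R := L)
  have hjX : seriesHom S PowerSeries.X = φ t := by rw [ht]; simp [seriesHom]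
  have hjC : ∀ c : S, seriesHom S (PowerSeries.C c) = HahnSeries.C (c : L) := by
    intro c; simp [seriesHom]
  have hX : φ t ≠ 0 := by
    rw [ht, Ne, map_eq_zero_iff _ hι]; exact PowerSeries.X_ne_zero
  have hφ' : ∀ n r, ∀ F : PowerSeries L, φ r = HahnSeries.ofPowerSeries ℤ L F →
      PowerSeries.coeff n F ∈ S := by
    intro n
    induction n with
    | zero =>
      intro r F hF
      obtain ⟨G, hG, hG'⟩ := h1 r
      rw [hι (hF.symm.trans hG)]
      simpa using hG'
    | succ n ih =>
      intro r F hF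
      obtain ⟨G, hG, hG'⟩ := h1 r
      rw [← hι (hF.symm.trans hG)] at hG'
      -- Removing the constant term by `r₀` leaves `t * r'`, and coefficient `n + 1` of `φ r` is
      -- coefficient `n` of `φ r'`.
      obtain ⟨r₀, hr₀⟩ := h2 _ hG'
      obtain ⟨F', hF'⟩ := powerSeries_eq_C_add_X_mul F
      have hs : φ (r - r₀) = HahnSeries.ofPowerSeries ℤ L (PowerSeries.X * F') := by
        rw [map_sub, hr₀, hF, ← HahnSeries.ofPowerSeries_C, ← map_sub]
        congr 1
        linear_combination hF'
      obtain ⟨r', hr'⟩ := h3 _ _ hs (by simp)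
      have hr1 : φ r' = HahnSeries.ofPowerSeries ℤ L F' := by
        rw [hr', map_mul, map_mul, ← ht] at hs
        exact mul_left_cancel₀ hX hs
      have := ih r' F' hr1
      rw [hF', map_add, PowerSeries.coeff_C, PowerSeries.coeff_succ_X_mul]
      simpa using this
  have hφ : ∀ r, ∃ s, seriesHom S s = φ r := by
    intro r
    obtain ⟨F, hF, -⟩ := h1 r
    exact mem_range_seriesHom.2 ⟨F, fun n => hφ' n r F hF, hF.symm⟩
  refine isCompletionIn_of_filtration _ φ (seriesHom S) (seriesHom_injective S)
    (fun n => Ideal.span {PowerSeries.X ^ n}) ?_ ?_ ?_ hφ ?_ ?_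
  · intro n
    rw [Ideal.span_singleton_le_span_singleton]
    exact pow_dvd_pow _ n.le_succ
  · intro s hs
    ext1 n
    have := hs (n + 1)
    rw [Ideal.mem_span_singleton, PowerSeries.X_pow_dvd_iff] at this
    simpa using this n n.lt_succ_self
  · intro s hs
    simp only [Ideal.mem_span_singleton, PowerSeries.X_pow_dvd_iff, map_sub, sub_eq_zero] at hs ⊢
    refine ⟨PowerSeries.mk fun n => PowerSeries.coeff n (s (n + 1)), fun n m hm => ?_⟩
    rw [PowerSeries.coeff_mk]
    induction n, hm using Nat.le_induction with
    | base => rfl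
    | succ n hmn ih => rw [ih, hs n m hmn]
  · intro n r s hs
    rw [Ideal.span_singleton_pow, Ideal.mem_span_singleton, Ideal.mem_span_singleton]
    constructor
    · rintro ⟨s', rfl⟩
      clear hφ'
      induction n generalizing r s' with
      | zero => simp
      | succ n ih =>
        obtain ⟨r', hr'⟩ := h3 r (PowerSeries.map S.subtype (PowerSeries.X ^ (n + 1) * s'))
          hs.symm (by simp)
        have := ih r' s' (by
          rw [pow_succ', mul_assoc, map_mul, hr', map_mul φ, hjX] at hs
          exact mul_left_cancel₀ hX hs)
        rw [hr', pow_succ']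
        exact mul_dvd_mul_left t this
    · rintro ⟨r', rfl⟩
      obtain ⟨s', hs'⟩ := hφ r'
      refine ⟨s', seriesHom_injective S ?_⟩
      rw [hs, map_mul, map_pow, map_mul, map_pow, hs', hjX]
  · intro n
    induction n with
    | zero => exact fun s => ⟨0, 0, by simp, by simp⟩
    | succ n ih =>
      intro s
      obtain ⟨s₁, hs₁⟩ := powerSeries_eq_C_add_X_mul s
      obtain ⟨r₁, s', h4, h5⟩ := ih s₁
      obtain ⟨r₀, hr₀⟩ := h2 _ (PowerSeries.constantCoeff s).2
      refine ⟨r₀ + t * r₁, PowerSeries.C (PowerSeries.constantCoeff s) + PowerSeries.X * s', ?_, ?_⟩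
      · rw [map_add, map_add, map_mul, map_mul, hjC, hjX, h4, hr₀]
      · rw [Ideal.mem_span_singleton] at h5 ⊢
        have : s - (PowerSeries.C (PowerSeries.constantCoeff s) + PowerSeries.X * s') =
            PowerSeries.X * (s₁ - s') := by
          linear_combination hs₁
        rw [this, pow_succ']
        exact mul_dvd_mul_left _ h5

end SeriesOver

/-! ### The completion `k'⟦q⟧` of `k[x]` and the coordinate ring of `U` -/

section Coordinates

variable {k : Type*} [Field k] (q : k[X]) [Fact (Irreducible q)]

/-- The variable of `k'((q))`. -/
def unif : LaurentSeries (ResField q) := HahnSeries.single (1 : ℤ) 1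

theorem ofPowerSeries_X_eq_unif :
    HahnSeries.ofPowerSeries ℤ (ResField q) PowerSeries.X = unif q := by
  simp [unif]

theorem unif_ne_zero : unif q ≠ 0 := by simp [unif]

theorem natDegree_pos_of_fact : 0 < q.natDegree := (Fact.out : Irreducible q).natDegree_pos

theorem ne_zero_of_fact : q ≠ 0 := (Fact.out : Irreducible q).ne_zero

/-- The subring `k'⟦q⟧` of `k'((q))`. -/
def integers : Subring (LaurentSeries (ResField q)) :=
  (HahnSeries.ofPowerSeries ℤ (ResField q)).range

theorem mem_integers_iff {z : LaurentSeries (ResField q)} :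
    z ∈ integers q ↔ ∃ s, HahnSeries.ofPowerSeries ℤ (ResField q) s = z := Iff.rfl

theorem exists_mul_unif_pow_mem_integers (z : LaurentSeries (ResField q)) :
    ∃ m, z * unif q ^ m ∈ integers q := by
  obtain ⟨l, hl⟩ : ∃ l : ℕ, (l : ℤ) = z.order + z.order.natAbs :=
    ⟨(z.order + z.order.natAbs).toNat, by omega⟩
  refine ⟨z.order.natAbs, PowerSeries.X ^ l * z.powerSeriesPart, ?_⟩
  rw [map_mul, LaurentSeries.ofPowerSeries_powerSeriesPart, HahnSeries.ofPowerSeries_X_pow,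
    unif, ← mul_assoc, HahnSeries.single_mul_single, mul_comm, HahnSeries.single_pow, hl]
  simp

variable [CharZero k]

/-- The embedding of `k[x]` into `k'⟦q⟧`. -/
def evalXi : k[X] →+* PowerSeries (ResField q) :=
  eval₂RingHom (PowerSeries.C.comp (AdjoinRoot.of q)) (xi q)

/-- The embedding of `k[x]` into `k'((q))`. -/
def evalXiL : k[X] →+* LaurentSeries (ResField q) := eval₂RingHom (baseHom q) (xiL q)

theorem evalXiL_eq (p : k[X]) :
    evalXiL q p = HahnSeries.ofPowerSeries ℤ _ (evalXi q p) := by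
  rw [evalXiL, evalXi, coe_eval₂RingHom, coe_eval₂RingHom, hom_eval₂]
  congr 1
  ext; simp [baseHom]

theorem evalXi_self : evalXi q q = PowerSeries.X := (existsUnique_xi q).choose_spec.1.1

theorem evalXiL_self : evalXiL q q = unif q := by
  rw [evalXiL_eq, evalXi_self, ofPowerSeries_X_eq_unif]

theorem evalXiL_X : evalXiL q X = xiL q := by simp [evalXiL]

theorem evalXiL_C (c : k) : evalXiL q (C c) = baseHom q c := by simp [evalXiL]

theorem constantCoeff_evalXi (p : k[X]) :
    PowerSeries.constantCoeff (evalXi q p) = AdjoinRoot.mk q p := by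
  rw [evalXi, coe_eval₂RingHom, hom_eval₂, ← RingHom.comp_assoc]
  have h2 : PowerSeries.constantCoeff (xi q) = AdjoinRoot.root q :=
    (existsUnique_xi q).choose_spec.1.2
  rw [h2, ← AdjoinRoot.aeval_eq, aeval_def]
  congr 1

theorem evalXiL_ne_zero {p : k[X]} (hp : p ≠ 0) : evalXiL q p ≠ 0 := eval_xi_ne_zero q hp

theorem evalXiL_injective : Function.Injective (evalXiL q) := by
  rw [injective_iff_map_eq_zero]
  intro p hp
  by_contra h
  exact evalXiL_ne_zero q h hp

theorem xiL_ne_zero : xiL q ≠ 0 := by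
  rw [← evalXiL_X]; exact evalXiL_ne_zero q X_ne_zero

theorem X_pow_dvd_evalXi_iff (n : ℕ) (p : k[X]) :
    PowerSeries.X ^ n ∣ evalXi q p ↔ q ^ n ∣ p := by
  constructor
  · intro h
    induction n generalizing p with
    | zero => simp
    | succ n ih =>
      have h1 : PowerSeries.X ∣ evalXi q p := (dvd_pow_self _ n.succ_ne_zero).trans h
      rw [PowerSeries.X_dvd_iff, constantCoeff_evalXi, AdjoinRoot.mk_eq_zero] at h1
      obtain ⟨p', rfl⟩ := h1
      rw [map_mul, evalXi_self, pow_succ'] at h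
      rw [pow_succ']
      exact mul_dvd_mul_left _ (ih _ ((mul_dvd_mul_iff_left PowerSeries.X_ne_zero).1 h))
  · rintro ⟨p', rfl⟩
    rw [map_mul, map_pow, evalXi_self]
    exact dvd_mul_right _ _

/-- Density of `k[x]` in `k'[[q]]`: the `q`-adic digits are chosen successively, each by lifting a
residue class from `k'` to `k[x]`. -/
theorem exists_X_pow_dvd_sub_evalXi (n : ℕ) (s : PowerSeries (ResField q)) :
    ∃ p : k[X], PowerSeries.X ^ n ∣ s - evalXi q p := by
  induction n with
  | zero => exact ⟨0, by simp⟩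
  | succ n ih =>
    obtain ⟨p, s', hs'⟩ := ih
    obtain ⟨c, hc⟩ := AdjoinRoot.mk_surjective (PowerSeries.constantCoeff s')
    obtain ⟨s'', hs''⟩ : PowerSeries.X ∣ s' - evalXi q c := by
      rw [PowerSeries.X_dvd_iff, map_sub, constantCoeff_evalXi, hc, sub_self]
    refine ⟨p + q ^ n * c, s'', ?_⟩
    rw [map_add, map_mul, map_pow, evalXi_self]
    linear_combination hs' + PowerSeries.X ^ n * hs''

theorem exists_degree_lt_X_pow_dvd_sub_evalXi (n : ℕ) (s : PowerSeries (ResField q)) :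
    ∃ p : k[X], p.degree < (q.natDegree * n : ℕ) ∧ PowerSeries.X ^ n ∣ s - evalXi q p := by
  obtain ⟨p, hp⟩ := exists_X_pow_dvd_sub_evalXi q n s
  have hq : q ^ n ≠ 0 := pow_ne_zero _ (ne_zero_of_fact q)
  refine ⟨p % q ^ n, ?_, ?_⟩
  · refine (EuclideanDomain.mod_lt p hq).trans_le ?_
    rw [degree_eq_natDegree hq, natDegree_pow, mul_comm]
  · have h1 : s - evalXi q (p % q ^ n) =
        (s - evalXi q p) + PowerSeries.X ^ n * evalXi q (p / q ^ n) := by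
      have := congrArg (evalXi q) (EuclideanDomain.div_add_mod p (q ^ n))
      rw [map_add, map_mul, map_pow, evalXi_self] at this
      linear_combination -this
    rw [h1]
    exact dvd_add hp (dvd_mul_right _ _)

/-- Division with remainder by `q` gives `f / q ^ (m + 1) = (f / q) / q ^ m + ((f % q) / q) * q⁻¹ ^
m`, where the quotient `f / q` inside the parentheses is Euclidean. The second summand is a
polynomial in the generators because `deg (f % q) < r`. -/
theorem evalXiL_div_unif_mem {f : k[X]} {m : ℕ} (hf : f.natDegree ≤ q.natDegree * m)
    {z : LaurentSeries (ResField q)} (hz : z * unif q ^ m = evalXiL q f) : z ∈ coordRingU q := by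
  have hw := unif_ne_zero q
  have hbase : ∀ c, baseHom q c ∈ coordRingU q :=
    fun c => Subring.subset_closure (Or.inl ⟨c, rfl⟩)
  have hgen : ∀ i < q.natDegree, xiL q ^ i * (unif q)⁻¹ ∈ coordRingU q :=
    fun i hi => Subring.subset_closure (Or.inr ⟨i, hi, rfl⟩)
  have hsmall : ∀ c : k[X], c.natDegree < q.natDegree →
      evalXiL q c * (unif q)⁻¹ ∈ coordRingU q := by
    intro c hc
    rw [evalXiL, coe_eval₂RingHom, eval₂_eq_sum_range, Finset.sum_mul]
    refine Subring.sum_mem _ fun i hi => ?_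
    rw [mul_assoc]
    refine Subring.mul_mem _ (hbase _) (hgen i ?_)
    have := Finset.mem_range.1 hi
    omega
  have hinv : (unif q)⁻¹ ∈ coordRingU q := by
    simpa using hgen 0 (natDegree_pos_of_fact q)
  induction m generalizing f z with
  | zero =>
    rw [pow_zero, mul_one] at hz
    obtain ⟨c, rfl⟩ := natDegree_eq_zero.1 (by simpa using hf)
    rw [hz, evalXiL_C]
    exact hbase _
  | succ m ih =>
    have hr := EuclideanDomain.div_add_mod f q
    have hc : (f % q).natDegree < q.natDegree :=
      natDegree_mod_lt f (natDegree_pos_of_fact q).ne'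
    have hg : (f / q).natDegree ≤ q.natDegree * m := by
      by_cases h0 : f / q = 0
      · simp [h0]
      have h1 : (q * (f / q)).natDegree ≤ q.natDegree * (m + 1) := by
        rw [eq_sub_of_add_eq hr]
        refine (natDegree_sub_le _ _).trans (max_le hf ?_)
        nlinarith
      rw [natDegree_mul (ne_zero_of_fact q) h0, mul_add, mul_one] at h1
      omega
    have h1 : (evalXiL q (f / q) * (unif q ^ m)⁻¹) ∈ coordRingU q :=
      ih hg (inv_mul_cancel_right₀ (pow_ne_zero _ hw) _)
    have h2 : z = evalXiL q (f / q) * (unif q ^ m)⁻¹ +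
        (evalXiL q (f % q) * (unif q)⁻¹) * (unif q)⁻¹ ^ m := by
      rw [← hr, map_add, map_mul, evalXiL_self] at hz
      rw [inv_pow]
      field_simp
      linear_combination hz
    rw [h2]
    exact Subring.add_mem _ h1 (Subring.mul_mem _ (hsmall _ hc) (Subring.pow_mem _ hinv _))

/-- Fractions `f / q ^ m` with `deg f ≤ r * m` form a ring containing the generators. Enlarging both
terms of the fraction by a power of `q` makes the exponent as large as desired. -/
theorem exists_evalXiL_of_mem {z : LaurentSeries (ResField q)} (hz : z ∈ coordRingU q) (n : ℕ) :
    ∃ m ≥ n, ∃ f : k[X], f.natDegree ≤ q.natDegree * m ∧ z * unif q ^ m = evalXiL q f := by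
  suffices h : ∃ m, ∃ f : k[X], f.natDegree ≤ q.natDegree * m ∧
      z * unif q ^ m = evalXiL q f by
    obtain ⟨m, f, hf, h⟩ := h
    refine ⟨m + n, Nat.le_add_left _ _, f * q ^ n, ?_, ?_⟩
    · refine natDegree_mul_le.trans ?_
      rw [natDegree_pow, mul_add, mul_comm n]
      exact Nat.add_le_add_right hf _
    · rw [map_mul, map_pow, evalXiL_self, ← h, pow_add, mul_assoc]
  have hw := unif_ne_zero q
  induction hz using Subring.closure_induction with
  | mem z hz =>
    rcases hz with ⟨c, rfl⟩ | ⟨i, hi, rfl⟩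
    · exact ⟨0, C c, by simp, by rw [evalXiL_C, pow_zero, mul_one]⟩
    · refine ⟨1, X ^ i, by simpa using hi.le, ?_⟩
      rw [pow_one, map_pow, evalXiL_X]
      exact inv_mul_cancel_right₀ hw _
  | zero => exact ⟨0, 0, by simp⟩
  | one => exact ⟨0, 1, by simp⟩
  | neg z _ ih =>
    obtain ⟨m, f, hf, h⟩ := ih
    exact ⟨m, -f, by simpa using hf, by rw [map_neg, ← h, neg_mul]⟩
  | add z z' _ _ ih ih' =>
    obtain ⟨m, f, hf, h⟩ := ih
    obtain ⟨m', f', hf', h'⟩ := ih'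
    refine ⟨m + m', f * q ^ m' + f' * q ^ m, ?_, ?_⟩
    · refine natDegree_add_le_of_degree_le (natDegree_mul_le.trans ?_) (natDegree_mul_le.trans ?_)
      · rw [natDegree_pow, mul_add, mul_comm m']
        exact Nat.add_le_add_right hf _
      · rw [natDegree_pow, mul_add, mul_comm m, add_comm]
        exact Nat.add_le_add_left hf' _
    · rw [map_add, map_mul, map_mul, map_pow, map_pow, evalXiL_self, ← h, ← h']
      ring
  | mul z z' _ _ ih ih' =>
    obtain ⟨m, f, hf, h⟩ := ih
    obtain ⟨m', f', hf', h'⟩ := ih'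
    refine ⟨m + m', f * f', ?_, ?_⟩
    · rw [mul_add]
      exact natDegree_mul_le.trans (Nat.add_le_add hf hf')
    · rw [map_mul, ← h, ← h']
      ring

theorem evalXiL_mem_integers (p : k[X]) : evalXiL q p ∈ integers q :=
  ⟨evalXi q p, (evalXiL_eq q p).symm⟩

/-- If `z = s / q ^ m` with `s` integral, approximate `s` modulo `q ^ m` by a polynomial `p` of
degree less than `r * m`. Then `p / q ^ m` is regular on `U` and carries the whole polar part of
`z`. -/
theorem exists_add_of_coordRingU_integers (z : LaurentSeries (ResField q)) :
    ∃ u ∈ coordRingU q, ∃ v ∈ integers q, z = u + v := by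
  have hw := unif_ne_zero q
  obtain ⟨m, s, hs⟩ := exists_mul_unif_pow_mem_integers q z
  obtain ⟨p, hp, s', hs'⟩ := exists_degree_lt_X_pow_dvd_sub_evalXi q m s
  have h1 : z - HahnSeries.ofPowerSeries ℤ _ s' ∈ coordRingU q := by
    refine evalXiL_div_unif_mem q (f := p) (m := m) (natDegree_le_of_degree_le hp.le) ?_
    have := congrArg (HahnSeries.ofPowerSeries ℤ (ResField q)) hs'
    rw [map_sub, map_mul, map_pow, ofPowerSeries_X_eq_unif, ← evalXiL_eq, hs] at this
    linear_combination this
  exact ⟨_, h1, _, ⟨s', rfl⟩, by ring⟩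

/-- A function with no pole at `P`, equal to `q ^ n` times a function regular on `U`, has its only
pole at infinity, of order at most `r * n`. Algebraically, integrality at `P` lets the remaining
power of `q` be cancelled from the numerator. -/
theorem exists_evalXiL_of_mem_integers {z : LaurentSeries (ResField q)} (hz : z ∈ integers q)
    {n : ℕ} {u : LaurentSeries (ResField q)} (hu : u ∈ coordRingU q) (h : z = u * unif q ^ n) :
    ∃ f : k[X], f.natDegree ≤ q.natDegree * n ∧ z = evalXiL q f := by
  have hw := unif_ne_zero q
  obtain ⟨m, hm, f, hf, h1⟩ := exists_evalXiL_of_mem q hu n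
  obtain ⟨l, rfl⟩ := Nat.exists_eq_add_of_le hm
  obtain ⟨s, rfl⟩ := hz
  have h2 : HahnSeries.ofPowerSeries ℤ _ s * unif q ^ l = evalXiL q f := by
    rw [← h1, h]; ring
  have h3 : PowerSeries.X ^ l ∣ evalXi q f := by
    refine ⟨s, HahnSeries.ofPowerSeries_injective (Γ := ℤ) ?_⟩
    rw [← evalXiL_eq, ← h2, map_mul, map_pow, ofPowerSeries_X_eq_unif, mul_comm]
  rw [X_pow_dvd_evalXi_iff] at h3
  obtain ⟨g, rfl⟩ := h3
  refine ⟨g, ?_, ?_⟩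
  · by_cases hg : g = 0
    · simp [hg]
    rw [natDegree_mul (pow_ne_zero _ (ne_zero_of_fact q)) hg, natDegree_pow, mul_add,
      mul_comm l] at hf
    omega
  · rw [map_mul, map_pow, evalXiL_self, mul_comm] at h2
    exact mul_left_cancel₀ (pow_ne_zero _ hw) h2

end Coordinates

/-! ### The embedding of `k((t))(x)` -/

section Embedding

variable {k : Type*} [Field k] (q : k[X]) [Fact (Irreducible q)]

theorem mapLaurent_ofPowerSeries {R S : Type*} [CommRing R] [CommRing S] (φ : R →+* S)
    (f : PowerSeries R) :
    mapLaurent φ (HahnSeries.ofPowerSeries ℤ R f) =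
      HahnSeries.ofPowerSeries ℤ S (PowerSeries.map φ f) := by
  ext n
  change φ ((HahnSeries.ofPowerSeries ℤ R f).coeff n) = _
  rw [PowerSeries.coeff_coe, PowerSeries.coeff_coe]
  split_ifs <;> simp

theorem mapLaurent_C {R S : Type*} [CommRing R] [CommRing S] (φ : R →+* S) (c : R) :
    mapLaurent φ (HahnSeries.C c) = HahnSeries.C (φ c) := by
  rw [← HahnSeries.ofPowerSeries_C, mapLaurent_ofPowerSeries, PowerSeries.map_C,
    HahnSeries.ofPowerSeries_C]

theorem C_X_dvd_of_map_constantCoeff_eq_zero {R : Type*} [CommRing R] {f : (PowerSeries R)[X]}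
    (h : f.map PowerSeries.constantCoeff = 0) : ∃ f', f = C PowerSeries.X * f' := by
  refine C_dvd_iff_dvd_coeff _ _ |>.2 fun i => ?_
  rw [PowerSeries.X_dvd_iff, ← coeff_map, h, coeff_zero]

/-- The map from the coordinate ring of an affine line over `k⟦t⟧` to `k'((q))⟦t⟧` which sends the
coordinate to `υ`. -/
def chartSeries (υ : LaurentSeries (ResField q)) :
    (PowerSeries k)[X] →+* PowerSeries (LaurentSeries (ResField q)) :=
  eval₂RingHom (PowerSeries.map (baseHom q)) (PowerSeries.C υ)

theorem constantCoeff_chartSeries (υ : LaurentSeries (ResField q)) (f : (PowerSeries k)[X]) :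
    PowerSeries.constantCoeff (chartSeries q υ f) =
      eval₂ (baseHom q) υ (f.map PowerSeries.constantCoeff) := by
  rw [chartSeries, coe_eval₂RingHom, hom_eval₂, eval₂_map]
  simp only [PowerSeries.constantCoeff_C]
  congr 1

theorem chart_C_X_mul (u : FunctionField k) (f : (PowerSeries k)[X]) :
    chart u (C PowerSeries.X * f) =
      constants k (HahnSeries.ofPowerSeries ℤ k PowerSeries.X) * chart u f := by
  rw [map_mul, chart_C]

theorem constants_t_ne_zero :
    constants k (HahnSeries.ofPowerSeries ℤ k PowerSeries.X) ≠ 0 := by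
  rw [_root_.map_ne_zero, Ne, map_eq_zero_iff _ HahnSeries.ofPowerSeries_injective]
  exact PowerSeries.X_ne_zero

variable [CharZero k]

theorem embed_algebraMap (p : (LaurentSeries k)[X]) :
    embed q (algebraMap _ (FunctionField k) p) = embedPoly q p := by
  have := RatFunc.liftRingHom_apply_div (embedPoly q)
    (nonZeroDivisors_le_comap_nonZeroDivisors_of_injective _ (embedPoly_injective q)) p 1
  rwa [map_one, map_one, div_one, div_one] at this

theorem embed_constants (c : LaurentSeries k) :
    embed q (constants k c) = mapLaurent (baseHom q) c := by
  rw [constants, ← RatFunc.algebraMap_C, embed_algebraMap, embedPoly, coe_eval₂RingHom, eval₂_C]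

theorem embed_X : embed q RatFunc.X = HahnSeries.C (xiL q) := by
  rw [← RatFunc.algebraMap_X, embed_algebraMap, embedPoly, coe_eval₂RingHom, eval₂_X]

theorem embed_X_inv : embed q (RatFunc.X⁻¹) = HahnSeries.C (xiL q)⁻¹ := by
  rw [map_inv₀, embed_X, map_inv₀]

theorem embed_ofPoly (p : k[X]) : embed q (ofPoly p) = HahnSeries.C (evalXiL q p) := by
  rw [ofPoly, embed_algebraMap, embedPoly, coe_eval₂RingHom, eval₂_map, evalXiL,
    coe_eval₂RingHom, hom_eval₂]
  congr 1
  ext1 c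
  exact mapLaurent_C _ _

theorem embed_t : embed q (constants k (HahnSeries.ofPowerSeries ℤ k PowerSeries.X)) =
    HahnSeries.ofPowerSeries ℤ _ PowerSeries.X := by
  rw [embed_constants, mapLaurent_ofPowerSeries, PowerSeries.map_X]

theorem embed_chart {u : FunctionField k} {υ : LaurentSeries (ResField q)}
    (hu : embed q u = HahnSeries.C υ) (f : (PowerSeries k)[X]) :
    embed q (chart u f) = HahnSeries.ofPowerSeries ℤ _ (chartSeries q υ f) := by
  rw [chart, chartSeries, coe_eval₂RingHom, coe_eval₂RingHom, hom_eval₂, hom_eval₂, hu,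
    HahnSeries.ofPowerSeries_C]
  congr 1
  ext1 c
  simp only [RingHom.comp_apply]
  rw [embed_constants, mapLaurent_ofPowerSeries]

/-- A denominator outside the prime has nonzero reduction modulo `t`, since `υ` is transcendental
over `k`; its image is thus a unit of `k'((q))[[t]]`. The constant coefficient of the quotient is
the reduced fraction, whose denominator still avoids `𝔭`. -/
theorem embed_eq_of_mem_localizationIn {u : FunctionField k} {υ : LaurentSeries (ResField q)}
    (hu : embed q u = HahnSeries.C υ) (hυ : Function.Injective (eval₂ (baseHom q) υ))
    {𝔭 : Ideal k[X]} [𝔭.IsPrime] {z : FunctionField k}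
    (hz : z ∈ localizationIn (chart u) (fibrePrime 𝔭)) :
    ∃ F, embed q z = HahnSeries.ofPowerSeries ℤ _ F ∧ ∃ f g : k[X], g ∉ 𝔭 ∧
      eval₂ (baseHom q) υ g * PowerSeries.constantCoeff F = eval₂ (baseHom q) υ f := by
  obtain ⟨f, g, hg, hg', rfl⟩ := hz
  have hg0 : eval₂ (baseHom q) υ (g.map PowerSeries.constantCoeff) ≠ 0 := by
    intro h
    refine hg ?_
    change g.map PowerSeries.constantCoeff ∈ 𝔭
    rw [hυ (h.trans (eval₂_zero _ _).symm)]
    exact 𝔭.zero_mem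
  have hG : PowerSeries.constantCoeff (chartSeries q υ g) ≠ 0 := by
    rwa [constantCoeff_chartSeries]
  have hG' : chartSeries q υ g ≠ 0 := fun h => hG (by rw [h, map_zero])
  refine ⟨chartSeries q υ f * (chartSeries q υ g)⁻¹, ?_, f.map PowerSeries.constantCoeff,
    g.map PowerSeries.constantCoeff, hg, ?_⟩
  · rw [map_div₀, embed_chart q hu, embed_chart q hu, div_eq_iff, ← map_mul, mul_assoc,
      PowerSeries.inv_mul_cancel _ hG, mul_one]
    rwa [Ne, map_eq_zero_iff _ HahnSeries.ofPowerSeries_injective]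
  · rw [map_mul, PowerSeries.constantCoeff_inv, constantCoeff_chartSeries,
      constantCoeff_chartSeries]
    field_simp

/-- If a fraction reduces to zero modulo `t`, so does its numerator, by injectivity of evaluation at
`υ`; a factor `t` can then be cancelled without touching the denominator. -/
theorem div_t_mem_localizationIn {u : FunctionField k} {υ : LaurentSeries (ResField q)}
    (hu : embed q u = HahnSeries.C υ) (hυ : Function.Injective (eval₂ (baseHom q) υ))
    {𝔭 : Ideal k[X]} [𝔭.IsPrime] {z : FunctionField k}
    (hz : z ∈ localizationIn (chart u) (fibrePrime 𝔭))
    {F : PowerSeries (LaurentSeries (ResField q))}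
    (hF : embed q z = HahnSeries.ofPowerSeries ℤ _ F) (hF0 : PowerSeries.constantCoeff F = 0) :
    z / constants k (HahnSeries.ofPowerSeries ℤ k PowerSeries.X) ∈
      localizationIn (chart u) (fibrePrime 𝔭) := by
  obtain ⟨f, g, hg, hg', rfl⟩ := hz
  have h1 : F * chartSeries q υ g = chartSeries q υ f := by
    refine HahnSeries.ofPowerSeries_injective (Γ := ℤ) ?_
    rw [map_mul, ← hF, ← embed_chart q hu, ← embed_chart q hu, ← map_mul,
      div_mul_cancel₀ _ hg']
  have h2 := congrArg PowerSeries.constantCoeff h1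
  rw [map_mul, hF0, zero_mul, constantCoeff_chartSeries] at h2
  obtain ⟨f', rfl⟩ := C_X_dvd_of_map_constantCoeff_eq_zero (hυ (h2.symm.trans (eval₂_zero _ _).symm))
  refine ⟨f', g, hg, hg', ?_⟩
  have ht := constants_t_ne_zero (k := k)
  rw [chart_C_X_mul]
  field_simp

theorem eval₂_xiL_injective : Function.Injective (eval₂ (baseHom q) (xiL q)) :=
  evalXiL_injective q

/-- Passage between the charts: coefficient reversal turns polynomials in `x⁻¹` into polynomials in
`x`. -/
theorem evalXiL_reflect {N : ℕ} {f : k[X]} (hf : f.natDegree ≤ N) :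
    evalXiL q (reflect N f) = eval₂ (baseHom q) (xiL q)⁻¹ f * xiL q ^ N := by
  have hξ := xiL_ne_zero q
  let : Invertible (xiL q)⁻¹ := invertibleOfNonzero (inv_ne_zero hξ)
  have h := eval₂_reflect_mul_pow (baseHom q) (xiL q)⁻¹ N f hf
  rw [invOf_eq_inv, inv_inv] at h
  rw [← h, mul_assoc, ← mul_pow, inv_mul_cancel₀ hξ, one_pow, mul_one]
  rfl

theorem eval₂_xiL_inv_injective : Function.Injective (eval₂ (baseHom q) (xiL q)⁻¹) := by
  rw [← coe_eval₂RingHom, injective_iff_map_eq_zero]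
  intro f hf
  rw [coe_eval₂RingHom] at hf
  have h := evalXiL_reflect q (le_refl f.natDegree)
  rw [hf, zero_mul] at h
  exact reflect_eq_zero_iff.1 (evalXiL_injective q (h.trans (map_zero _).symm))

end Embedding

/-! ### The completion of `R_U` -/

section RingU

variable {k : Type*} [Field k] (q : k[X]) [Fact (Irreducible q)] [CharZero k]

omit [Fact (Irreducible q)] [CharZero k] in
theorem mem_ringU_iff {z : FunctionField k} : z ∈ ringU q ↔
    (∀ (𝔭 : Ideal k[X]) (_ : 𝔭.IsPrime), 𝔭 ≠ Ideal.span {q} →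
      z ∈ localizationIn (chart RatFunc.X) (fibrePrime 𝔭)) ∧
    z ∈ localizationIn (chart RatFunc.X⁻¹) (fibrePrime (Ideal.span {(X : k[X])})) := by
  rw [ringU, Subring.mem_inf]
  simp only [Subring.mem_iInf]

/-- The denominators of `z` form an ideal of `k[x]` that lies in no prime other than possibly `(q)`.
Hence `q` belongs to its radical, and some power of `q` is a denominator. -/
theorem exists_pow_mul_eq_evalXiL {z : LaurentSeries (ResField q)}
    (hz : ∀ (𝔭 : Ideal k[X]) (_ : 𝔭.IsPrime), 𝔭 ≠ Ideal.span {q} →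
      ∃ f g : k[X], g ∉ 𝔭 ∧ evalXiL q g * z = evalXiL q f) :
    ∃ m, ∃ h : k[X], z * unif q ^ m = evalXiL q h := by
  let 𝔞 : Ideal k[X] :=
    { carrier := {g | ∃ f, evalXiL q g * z = evalXiL q f}
      zero_mem' := ⟨0, by simp⟩
      add_mem' := by
        rintro g g' ⟨f, hf⟩ ⟨f', hf'⟩
        exact ⟨f + f', by rw [map_add, map_add, add_mul, hf, hf']⟩
      smul_mem' := by
        rintro c g ⟨f, hf⟩
        exact ⟨c * f, by rw [smul_eq_mul, map_mul, map_mul, mul_assoc, hf]⟩ }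
  have hq : q ∈ 𝔞.radical := by
    rw [Ideal.radical_eq_sInf, Ideal.mem_sInf]
    rintro 𝔭 ⟨h1, h2⟩
    by_cases h : 𝔭 = Ideal.span {q}
    · rw [h]; exact Ideal.mem_span_singleton_self q
    · obtain ⟨f, g, hg, hfg⟩ := hz 𝔭 h2 h
      exact absurd (h1 ⟨f, hfg⟩) hg
  obtain ⟨m, h, hm⟩ := hq
  exact ⟨m, h, by rw [← hm, map_pow, evalXiL_self, mul_comm]⟩

/-- Regularity at infinity bounds the degree of the numerator. As `b` has nonzero constant term, its
reversal at `N` has degree `N`, and comparing degrees in the cleared equation gives `deg h ≤ r * m`.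
-/
theorem mem_coordRingU_of_regular {z : LaurentSeries (ResField q)} {m : ℕ} {h a b : k[X]}
    (hz : z * unif q ^ m = evalXiL q h) (hb : b ∉ Ideal.span {(X : k[X])})
    (hab : eval₂ (baseHom q) (xiL q)⁻¹ b * z = eval₂ (baseHom q) (xiL q)⁻¹ a) :
    z ∈ coordRingU q := by
  refine evalXiL_div_unif_mem q ?_ hz
  rw [Ideal.mem_span_singleton, X_dvd_iff] at hb
  set N := max a.natDegree b.natDegree with hN
  have h1 : reflect N b * h = reflect N a * q ^ m := by
    apply evalXiL_injective q
    rw [map_mul, map_mul, map_pow, evalXiL_self, evalXiL_reflect q (le_max_right _ _),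
      evalXiL_reflect q (le_max_left _ _), ← hz, ← hab]
    ring
  have hNb : N ≤ (reflect N b).natDegree := by
    refine le_natDegree_of_ne_zero ?_
    rwa [coeff_reflect, revAt_le le_rfl, Nat.sub_self]
  have hNa : (reflect N a).natDegree ≤ N :=
    (natDegree_reflect_le ..).trans (max_le le_rfl (le_max_left _ _))
  by_cases h0 : h = 0
  · simp [h0]
  have hb0 : reflect N b ≠ 0 := by
    rw [Ne, reflect_eq_zero_iff]
    rintro rfl
    simp at hb
  have h2 := congrArg natDegree h1
  rw [natDegree_mul hb0 h0] at h2
  have h3 : (reflect N a * q ^ m).natDegree ≤ N + q.natDegree * m :=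
    natDegree_mul_le.trans (Nat.add_le_add hNa (by rw [natDegree_pow, mul_comm]))
  omega

theorem embed_eq_of_mem_ringU {z : FunctionField k} (hz : z ∈ ringU q) :
    ∃ F, embed q z = HahnSeries.ofPowerSeries ℤ _ F ∧
      PowerSeries.constantCoeff F ∈ coordRingU q := by
  rw [mem_ringU_iff] at hz
  obtain ⟨F, hF, a, b, hb, hab⟩ :=
    embed_eq_of_mem_localizationIn q (embed_X_inv q) (eval₂_xiL_inv_injective q) hz.2
  refine ⟨F, hF, ?_⟩
  obtain ⟨m, h, hm⟩ := exists_pow_mul_eq_evalXiL q (z := PowerSeries.constantCoeff F) (by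
    intro 𝔭 h1 h2
    obtain ⟨G, hG, f, g, hg, hfg⟩ :=
      embed_eq_of_mem_localizationIn q (embed_X q) (eval₂_xiL_injective q) (hz.1 𝔭 h1 h2)
    rw [HahnSeries.ofPowerSeries_injective (hF.symm.trans hG)]
    exact ⟨f, g, hg, hfg⟩)
  exact mem_coordRingU_of_regular q hm hb hab

omit [CharZero k] in
theorem chart_map_C (u : FunctionField k) (f : k[X]) :
    chart u (f.map PowerSeries.C) = eval₂ ((constants k).comp HahnSeries.C) u f := by
  rw [chart, coe_eval₂RingHom, eval₂_map]
  congr 1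
  ext1 c
  simp

omit [CharZero k] in
theorem ofPoly_eq_eval₂ (f : k[X]) :
    ofPoly f = eval₂ ((constants k).comp HahnSeries.C) RatFunc.X f := by
  rw [ofPoly, ← RatFunc.algebraMap_X, ← coe_eval₂RingHom]
  induction f using Polynomial.induction_on' with
  | add p q hp hq => rw [Polynomial.map_add, map_add, hp, hq, map_add]
  | monomial n a => simp [← C_mul_X_pow_eq_monomial, RatFunc.algebraMap_C]

omit [CharZero k] in
theorem chart_X_map_C (f : k[X]) : chart RatFunc.X (f.map PowerSeries.C) = ofPoly f := by
  rw [chart_map_C, ofPoly_eq_eval₂]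

omit [Fact (Irreducible q)] [CharZero k] in
theorem ofPoly_ne_zero {f : k[X]} (hf : f ≠ 0) : ofPoly f ≠ 0 := by
  rw [ofPoly, Ne, map_eq_zero_iff _ (RatFunc.algebraMap_injective _),
    Polynomial.map_eq_zero_iff HahnSeries.C_injective]
  exact hf

omit [CharZero k] in
theorem map_C_mem_fibrePrime_iff {𝔭 : Ideal k[X]} {f : k[X]} :
    f.map PowerSeries.C ∈ fibrePrime 𝔭 ↔ f ∈ 𝔭 := by
  change (f.map PowerSeries.C).map PowerSeries.constantCoeff ∈ 𝔭 ↔ _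
  rw [Polynomial.map_map]
  have : (PowerSeries.constantCoeff (R := k)).comp PowerSeries.C = RingHom.id k := by
    ext; simp
  rw [this, Polynomial.map_id]

omit [CharZero k] in
theorem ofPoly_div_mem_ringU {i : ℕ} (hi : i ≤ q.natDegree) :
    RatFunc.X ^ i / ofPoly q ∈ ringU q := by
  have hq := Fact.out (p := Irreducible q)
  rw [mem_ringU_iff]
  constructor
  · intro 𝔭 hp hne
    refine ⟨X ^ i, q.map PowerSeries.C, ?_, ?_, ?_⟩
    · rw [map_C_mem_fibrePrime_iff]
      intro h
      refine hne (((PrincipalIdealRing.isMaximal_of_irreducible hq).eq_of_le hp.ne_top ?_).symm)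
      rwa [Ideal.span_singleton_le_iff_mem]
    · rw [chart_X_map_C]
      exact ofPoly_ne_zero hq.ne_zero
    · rw [chart_X_map_C, map_pow]
      simp [chart]
  -- At infinity `x ^ i / q` is `(x⁻¹) ^ (r - i)` divided by the reversal of `q` at `x⁻¹`, whose
  -- constant term is the leading coefficient of `q` and hence nonzero.
  · have hrev : chart (RatFunc.X (K := LaurentSeries k))⁻¹ (q.reverse.map PowerSeries.C) *
        RatFunc.X ^ q.natDegree = ofPoly q := by
      let : Invertible (RatFunc.X (K := LaurentSeries k)) := invertibleOfNonzero RatFunc.X_ne_zero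
      rw [chart_map_C, ofPoly_eq_eval₂, ← eval₂_reverse_mul_pow _ RatFunc.X q, invOf_eq_inv]
    have h0 := ofPoly_ne_zero hq.ne_zero
    refine ⟨X ^ (q.natDegree - i), q.reverse.map PowerSeries.C, ?_, ?_, ?_⟩
    · rw [map_C_mem_fibrePrime_iff, Ideal.mem_span_singleton, X_dvd_iff, coeff_zero_reverse,
        leadingCoeff_eq_zero]
      exact hq.ne_zero
    · intro h
      rw [h, zero_mul] at hrev
      exact h0 hrev.symm
    · have hX := RatFunc.X_ne_zero (K := LaurentSeries k)
      have h1 : chart (RatFunc.X (K := LaurentSeries k))⁻¹ (q.reverse.map PowerSeries.C) ≠ 0 := by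
        intro h
        rw [h, zero_mul] at hrev
        exact h0 hrev.symm
      have h2 : chart (RatFunc.X (K := LaurentSeries k))⁻¹ (X ^ (q.natDegree - i)) *
          RatFunc.X ^ q.natDegree = RatFunc.X ^ i := by
        rw [map_pow, chart, coe_eval₂RingHom, eval₂_X, inv_pow]
        field_simp
        rw [← pow_add]
        congr 1
        omega
      rw [div_eq_div_iff h0 h1, ← hrev, ← h2]
      ring

/-- Each element of the coordinate ring of `U` lifts to an element of `R_U` that is constant in `t`;
it suffices to lift the generators. -/
theorem coordRingU_le : coordRingU q ≤ ((ringU q).map (embed q)).comap HahnSeries.C := by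
  rw [coordRingU, Subring.closure_le]
  rintro _ (⟨c, rfl⟩ | ⟨i, hi, rfl⟩)
  · refine ⟨constants k (HahnSeries.C c), ?_, ?_⟩
    · have h : ∀ u, constants k (HahnSeries.C c) = chart u (C (PowerSeries.C c)) := by
        intro u
        rw [chart_C, HahnSeries.ofPowerSeries_C]
      refine (mem_ringU_iff q).2 ⟨fun 𝔭 _ _ => ?_, ?_⟩
      · rw [h RatFunc.X]; exact mem_localizationIn _ _ _
      · rw [h RatFunc.X⁻¹]; exact mem_localizationIn _ _ _
    · rw [embed_constants, mapLaurent_C]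
  · refine ⟨_, ofPoly_div_mem_ringU q hi.le, ?_⟩
    rw [map_div₀, map_pow, embed_X, embed_ofPoly, evalXiL_self, div_eq_mul_inv, map_mul, map_pow,
      map_inv₀ HahnSeries.C]
    rfl

theorem isCompletionIn_ringUhat :
    IsCompletionIn (Ideal.span {ringUt q}) ((embed q).comp (ringU q).subtype) (ringUhat q) := by
  refine isCompletionIn_seriesHom (ringUt q) _ (coordRingU q) (embed_t q)
    (fun r => embed_eq_of_mem_ringU q r.2) ?_ ?_
  · intro c hc
    obtain ⟨r, hr, h⟩ := coordRingU_le q hc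
    exact ⟨⟨r, hr⟩, h⟩
  · intro r F hF hF0
    have hr := (mem_ringU_iff q).1 r.2
    refine ⟨⟨_, (mem_ringU_iff q).2 ⟨fun 𝔭 h1 h2 => div_t_mem_localizationIn q (embed_X q)
      (eval₂_xiL_injective q) (hr.1 𝔭 h1 h2) hF hF0, div_t_mem_localizationIn q (embed_X_inv q)
      (eval₂_xiL_inv_injective q) hr.2 hF hF0⟩⟩, Subtype.ext ?_⟩
    exact (mul_div_cancel₀ _ constants_t_ne_zero).symm

end RingU

/-! ### The completion of the localization of `k'⟦q, t⟧` at `(t)` -/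

section RingPcirc

variable {k : Type*} [Field k] (q : k[X]) [Fact (Irreducible q)]

theorem doubleSeries_apply (f : PowerSeries (PowerSeries (ResField q))) :
    doubleSeries q f = HahnSeries.ofPowerSeries ℤ (LaurentSeries (ResField q))
      (PowerSeries.map (HahnSeries.ofPowerSeries ℤ (ResField q)) f) := rfl

theorem doubleSeries_injective : Function.Injective (doubleSeries q) := by
  intro f g h
  rw [doubleSeries_apply, doubleSeries_apply] at h
  have h1 := HahnSeries.ofPowerSeries_injective h
  ext1 n
  have h2 := congrArg (PowerSeries.coeff n) h1
  rw [PowerSeries.coeff_map, PowerSeries.coeff_map] at h2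
  exact HahnSeries.ofPowerSeries_injective h2

theorem doubleSeries_X : doubleSeries q PowerSeries.X = HahnSeries.ofPowerSeries ℤ _ PowerSeries.X := by
  rw [doubleSeries_apply, PowerSeries.map_X]

theorem doubleSeries_C (c : PowerSeries (ResField q)) : doubleSeries q (PowerSeries.C c) =
    HahnSeries.C (HahnSeries.ofPowerSeries ℤ _ c) := by
  rw [doubleSeries_apply, PowerSeries.map_C, HahnSeries.ofPowerSeries_C]

theorem ringPcirc_eq : ringPcirc q = (seriesHom (⊤ : Subring (LaurentSeries (ResField q)))).range := by
  ext z
  rw [mem_range_seriesHom]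
  exact ⟨fun ⟨f, hf⟩ => ⟨f, fun _ => Subring.mem_top _, hf⟩, fun ⟨f, _, hf⟩ => ⟨f, hf⟩⟩

/-- In the localization at `(t)` the element `q` is invertible, so every constant `s / q ^ m` of
`k'((q))` occurs, and the criterion for powers of `t` applies with all of `k'((q))` as coefficient
ring. -/
theorem isCompletionIn_ringPcirc :
    IsCompletionIn (localizationIdeal (doubleSeries q) (Ideal.span {PowerSeries.X}))
      (Subring.subtype _) (ringPcirc q) := by
  have hι := HahnSeries.ofPowerSeries_injective (Γ := ℤ) (R := LaurentSeries (ResField q))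
  have hI : localizationIdeal (doubleSeries q) (Ideal.span {PowerSeries.X}) =
      Ideal.span {(⟨doubleSeries q PowerSeries.X, mem_localizationIn _ _ _⟩ :
        localizationIn (doubleSeries q) (Ideal.span {PowerSeries.X}))} := by
    rw [localizationIdeal, Ideal.map_span, Set.image_singleton]
    rfl
  have hg : ∀ g : PowerSeries (PowerSeries (ResField q)), g ∉ Ideal.span {PowerSeries.X} →
      PowerSeries.constantCoeff (PowerSeries.map (HahnSeries.ofPowerSeries ℤ (ResField q)) g) ≠ 0 := by
    intro g hg h
    rw [Ideal.mem_span_singleton, PowerSeries.X_dvd_iff] at hg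
    apply hg
    refine HahnSeries.ofPowerSeries_injective (Γ := ℤ) ?_
    rw [map_zero, ← h, ← PowerSeries.coeff_zero_eq_constantCoeff_apply,
      ← PowerSeries.coeff_zero_eq_constantCoeff_apply, PowerSeries.coeff_map]
  rw [hI, ringPcirc_eq]
  refine isCompletionIn_seriesHom _ _ ⊤ (doubleSeries_X q) ?_ ?_ ?_
  · rintro ⟨_, f, g, hg1, hg2, rfl⟩
    refine ⟨PowerSeries.map (HahnSeries.ofPowerSeries ℤ (ResField q)) f *
      (PowerSeries.map (HahnSeries.ofPowerSeries ℤ (ResField q)) g)⁻¹, ?_, Subring.mem_top _⟩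
    rw [Subring.subtype_apply, div_eq_iff hg2, doubleSeries_apply, doubleSeries_apply, ← map_mul,
      mul_assoc, PowerSeries.inv_mul_cancel _ (hg g hg1), mul_one]
  · intro c _
    obtain ⟨m, s, hs⟩ := exists_mul_unif_pow_mem_integers q c
    have h0 : doubleSeries q (PowerSeries.C (PowerSeries.X ^ m)) ≠ 0 := by
      rw [Ne, map_eq_zero_iff _ (doubleSeries_injective q),
        map_eq_zero_iff _ PowerSeries.C_injective]
      exact pow_ne_zero _ PowerSeries.X_ne_zero
    refine ⟨⟨_, PowerSeries.C s, PowerSeries.C (PowerSeries.X ^ m), ?_, h0, rfl⟩, ?_⟩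
    · rw [Ideal.mem_span_singleton, PowerSeries.X_dvd_iff]
      simp
    · rw [Subring.subtype_apply, div_eq_iff h0, doubleSeries_C, doubleSeries_C, hs, map_pow,
        ofPowerSeries_X_eq_unif, ← map_mul]
  · rintro ⟨_, f, g, hg1, hg2, rfl⟩ F hF hF0
    rw [Subring.subtype_apply, div_eq_iff hg2, doubleSeries_apply, doubleSeries_apply,
      ← map_mul] at hF
    have h1 := congrArg PowerSeries.constantCoeff (hι hF)
    rw [map_mul, hF0, zero_mul, ← PowerSeries.coeff_zero_eq_constantCoeff_apply,
      PowerSeries.coeff_map, map_eq_zero_iff _ HahnSeries.ofPowerSeries_injective,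
      PowerSeries.coeff_zero_eq_constantCoeff_apply, ← PowerSeries.X_dvd_iff] at h1
    obtain ⟨f', rfl⟩ := h1
    refine ⟨⟨_, f', g, hg1, hg2, rfl⟩, Subtype.ext ?_⟩
    exact (congrArg (· / doubleSeries q g) (map_mul (doubleSeries q) _ f')).trans
      (mul_div_assoc _ _ _)

theorem exists_pow_mul_eq_ofPowerSeries {L : Type*} [Field L] (z : LaurentSeries L) :
    ∃ (n : ℕ) (f : PowerSeries L),
      HahnSeries.ofPowerSeries ℤ L PowerSeries.X ^ n * z = HahnSeries.ofPowerSeries ℤ L f := by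
  obtain ⟨l, hl⟩ : ∃ l : ℕ, (l : ℤ) = z.order + z.order.natAbs :=
    ⟨(z.order + z.order.natAbs).toNat, by omega⟩
  refine ⟨z.order.natAbs, PowerSeries.X ^ l * z.powerSeriesPart, ?_⟩
  rw [map_mul, LaurentSeries.ofPowerSeries_powerSeriesPart, HahnSeries.ofPowerSeries_X_pow,
    ← mul_assoc, HahnSeries.single_mul_single, ← map_pow, HahnSeries.ofPowerSeries_X_pow, hl]
  simp

theorem fractionField_ringPcirc : fractionField (ringPcirc q) = ⊤ := by
  refine eq_top_iff.2 fun z _ => ?_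
  obtain ⟨n, f, h⟩ := exists_pow_mul_eq_ofPowerSeries z
  have hX : HahnSeries.ofPowerSeries ℤ (LaurentSeries (ResField q)) PowerSeries.X ≠ 0 := by
    rw [Ne, map_eq_zero_iff _ HahnSeries.ofPowerSeries_injective]
    exact PowerSeries.X_ne_zero
  have hmem : ∀ f, HahnSeries.ofPowerSeries ℤ (LaurentSeries (ResField q)) f ∈
      fractionField (ringPcirc q) :=
    fun f => Subfield.subset_closure (RingHom.mem_range_self _ f)
  have hz : z = HahnSeries.ofPowerSeries ℤ _ f / HahnSeries.ofPowerSeries ℤ _ PowerSeries.X ^ n := by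
    rw [eq_div_iff (pow_ne_zero n hX), mul_comm, h]
  rw [hz]
  exact div_mem (hmem f) (pow_mem (hmem _) n)

end RingPcirc

/-! ### The completion of `R_P` -/

section TotalDegree

variable {K : Type*} [Field K]

/-- The ideal `(w, t)ⁿ` of `K⟦w⟧⟦t⟧`: the series without terms of total degree less than `n`. -/
def totalDegreeIdeal (K : Type*) [Field K] (n : ℕ) : Ideal (PowerSeries (PowerSeries K)) where
  carrier := {s | ∀ i j, i + j < n → PowerSeries.coeff j (PowerSeries.coeff i s) = 0}
  zero_mem' := by simp
  add_mem' := by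
    intro s s' h h' i j hij
    rw [map_add, map_add, h i j hij, h' i j hij, add_zero]
  smul_mem' := by
    intro c s h i j hij
    rw [smul_eq_mul, PowerSeries.coeff_mul, map_sum]
    refine Finset.sum_eq_zero fun x hx => ?_
    rw [PowerSeries.coeff_mul]
    refine Finset.sum_eq_zero fun y hy => ?_
    rw [Finset.HasAntidiagonal.mem_antidiagonal] at hx hy
    rw [h _ _ (by omega), mul_zero]

theorem totalDegreeIdeal_mul_le (m n : ℕ) :
    totalDegreeIdeal K m * totalDegreeIdeal K n ≤ totalDegreeIdeal K (m + n) := by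
  rw [Ideal.mul_le]
  intro r hr s hs i j hij
  rw [PowerSeries.coeff_mul, map_sum]
  refine Finset.sum_eq_zero fun x hx => ?_
  rw [PowerSeries.coeff_mul]
  refine Finset.sum_eq_zero fun y hy => ?_
  rw [Finset.HasAntidiagonal.mem_antidiagonal] at hx hy
  by_cases h : x.1 + y.1 < m
  · rw [hr _ _ h, zero_mul]
  · rw [hs _ _ (by omega), mul_zero]

theorem totalDegreeIdeal_one_pow_le (n : ℕ) :
    totalDegreeIdeal K 1 ^ n ≤ totalDegreeIdeal K n := by
  induction n with
  | zero => exact fun s _ i j h => absurd h (Nat.not_lt_zero _)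
  | succ n ih =>
    rw [pow_succ]
    exact (Ideal.mul_mono_left ih).trans (totalDegreeIdeal_mul_le n 1)

theorem X_mul_mem_totalDegreeIdeal_iff {n : ℕ} {s : PowerSeries (PowerSeries K)} :
    PowerSeries.X * s ∈ totalDegreeIdeal K (n + 1) ↔ s ∈ totalDegreeIdeal K n := by
  constructor
  · intro h i j hij
    rw [← PowerSeries.coeff_succ_X_mul i s]
    exact h (i + 1) j (by omega)
  · intro h i j hij
    cases i with
    | zero => simp
    | succ i =>
      rw [PowerSeries.coeff_succ_X_mul]
      exact h _ _ (by omega)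

theorem C_mem_totalDegreeIdeal {n : ℕ} {c : PowerSeries K} (h : PowerSeries.X ^ n ∣ c) :
    PowerSeries.C c ∈ totalDegreeIdeal K n := by
  intro i j hij
  rw [PowerSeries.coeff_C]
  split_ifs
  · exact PowerSeries.X_pow_dvd_iff.1 h j (by omega)
  · simp

theorem X_pow_dvd_constantCoeff {n : ℕ} {s : PowerSeries (PowerSeries K)}
    (h : s ∈ totalDegreeIdeal K n) : PowerSeries.X ^ n ∣ PowerSeries.constantCoeff s := by
  rw [PowerSeries.X_pow_dvd_iff, ← PowerSeries.coeff_zero_eq_constantCoeff_apply]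
  exact fun j hj => h 0 j (by omega)

end TotalDegree

section RingP

variable {k : Type*} [Field k] (q : k[X]) [Fact (Irreducible q)] [CharZero k]

/-- The embedding of `k⟦t⟧[x]` into `k'⟦q, t⟧`. -/
def polySeries : (PowerSeries k)[X] →+* PowerSeries (PowerSeries (ResField q)) :=
  eval₂RingHom (PowerSeries.map (PowerSeries.C.comp (AdjoinRoot.of q))) (PowerSeries.C (xi q))

theorem constantCoeff_polySeries (f : (PowerSeries k)[X]) :
    PowerSeries.constantCoeff (polySeries q f) =
      evalXi q (f.map PowerSeries.constantCoeff) := by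
  rw [polySeries, coe_eval₂RingHom, hom_eval₂, evalXi, coe_eval₂RingHom, eval₂_map]
  simp only [PowerSeries.constantCoeff_C]
  congr 1

theorem polySeries_map_C (p : k[X]) :
    polySeries q (p.map PowerSeries.C) = PowerSeries.C (evalXi q p) := by
  rw [polySeries, coe_eval₂RingHom, eval₂_map, evalXi, coe_eval₂RingHom, hom_eval₂]
  congr 1
  ext1 c
  simp

theorem embed_chart_X (f : (PowerSeries k)[X]) :
    embed q (chart RatFunc.X f) = doubleSeries q (polySeries q f) := by
  rw [embed_chart q (embed_X q), doubleSeries_apply]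
  congr 1
  rw [polySeries, chartSeries, coe_eval₂RingHom, coe_eval₂RingHom, hom_eval₂, PowerSeries.map_C]
  congr 1
  ext f n : 2
  simp [baseHom]

theorem isUnit_polySeries {g : (PowerSeries k)[X]} (hg : g ∉ fibrePrime (Ideal.span {q})) :
    IsUnit (polySeries q g) := by
  rw [PowerSeries.isUnit_iff_constantCoeff, PowerSeries.isUnit_iff_constantCoeff,
    constantCoeff_polySeries, constantCoeff_evalXi, isUnit_iff_ne_zero, Ne,
    AdjoinRoot.mk_eq_zero, ← Ideal.mem_span_singleton]
  exact hg

/-- Elements outside the maximal ideal become units of `k'[[q,t]]`, so the local ring maps there.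
Its maximal ideal contains `q` and `t` and maps into total degree at least `1`; the converse
inclusion `hge` and density both proceed by peeling off the constant term in `t` and dividing the
rest by `t`. -/
theorem isCompletionIn_ringPhat :
    IsCompletionIn (localizationIdeal (chart RatFunc.X) (fibrePrime (Ideal.span {q})))
      ((embed q).comp (Subring.subtype _)) (ringPhat q) := by
  have hj := doubleSeries_injective q
  set φ := (embed q).comp (Subring.subtype
    (localizationIn (chart RatFunc.X) (fibrePrime (Ideal.span {q})))) with hφdef
  set I := localizationIdeal (chart RatFunc.X) (fibrePrime (Ideal.span {q})) with hIdef
  set ρ := (chart RatFunc.X).codRestrict (localizationIn (chart RatFunc.X)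
    (fibrePrime (Ideal.span {q}))) (mem_localizationIn _ _) with hρdef
  have hρ : ∀ f, φ (ρ f) = doubleSeries q (polySeries q f) := embed_chart_X q
  have hfrac : ∀ r, ∃ f g, g ∉ fibrePrime (Ideal.span {q}) ∧ r * ρ g = ρ f := by
    rintro ⟨_, f, g, hg, hg', rfl⟩
    exact ⟨f, g, hg, Subtype.ext (div_mul_cancel₀ _ hg')⟩
  have hinv : ∀ g, g ∉ fibrePrime (Ideal.span {q}) → ∃ r, r * ρ g = 1 := by
    intro g hg
    have hg' : chart (RatFunc.X (K := LaurentSeries k)) g ≠ 0 := by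
      intro h
      have h1 := embed_chart_X q g
      rw [h, map_zero, eq_comm, map_eq_zero_iff _ hj] at h1
      exact (isUnit_polySeries q hg).ne_zero h1
    refine ⟨⟨_, 1, g, hg, hg', rfl⟩, Subtype.ext ?_⟩
    change chart RatFunc.X 1 / chart RatFunc.X g * chart RatFunc.X g = 1
    rw [div_mul_cancel₀ _ hg', map_one]
  have hφ : ∀ r, ∃ s, doubleSeries q s = φ r := by
    intro r
    obtain ⟨f, g, hg, h⟩ := hfrac r
    obtain ⟨u, hu⟩ := isUnit_polySeries q hg
    refine ⟨polySeries q f * ((u⁻¹ : Units _) : PowerSeries (PowerSeries (ResField q))), ?_⟩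
    rw [map_mul, ← hρ, ← h, map_mul, hρ, mul_assoc, ← map_mul, ← hu, Units.mul_inv, map_one,
      mul_one]
  obtain ⟨ψ, hψ⟩ := exists_ringHom_lift φ (doubleSeries q) hj hφ
  have hψρ : ∀ f, ψ (ρ f) = polySeries q f := fun f => hj ((hψ _).trans (hρ f))
  have hρI : ∀ f ∈ fibrePrime (Ideal.span {q}), ρ f ∈ I := fun f hf => Ideal.mem_map_of_mem _ hf
  have htI : ρ (C PowerSeries.X) ∈ I := by
    refine hρI _ ?_
    change (C PowerSeries.X).map PowerSeries.constantCoeff ∈ Ideal.span {q}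
    simp
  have hqI : ρ (q.map PowerSeries.C) ∈ I := by
    refine hρI _ ?_
    rw [map_C_mem_fibrePrime_iff]
    exact Ideal.mem_span_singleton_self q
  have hψt : ψ (ρ (C PowerSeries.X)) = PowerSeries.X := by
    rw [hψρ]; simp [polySeries]
  have hle : I ≤ (totalDegreeIdeal (ResField q) 1).comap ψ := by
    rw [hIdef, localizationIdeal, Ideal.map_le_iff_le_comap]
    intro f hf
    change ψ (ρ f) ∈ totalDegreeIdeal (ResField q) 1
    rw [hψρ]
    intro i j hij
    obtain ⟨rfl, rfl⟩ : i = 0 ∧ j = 0 := by omega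
    rw [PowerSeries.coeff_zero_eq_constantCoeff_apply, PowerSeries.coeff_zero_eq_constantCoeff_apply,
      constantCoeff_polySeries, constantCoeff_evalXi, AdjoinRoot.mk_eq_zero,
      ← Ideal.mem_span_singleton]
    exact hf
  have hge : ∀ n r, ψ r ∈ totalDegreeIdeal (ResField q) n → r ∈ I ^ n := by
    intro n
    induction n with
    | zero => simp
    | succ n ih =>
      intro r hr
      obtain ⟨f, g, hg, hfg⟩ := hfrac r
      obtain ⟨g', hg'⟩ := hinv g hg
      have hf : polySeries q f ∈ totalDegreeIdeal (ResField q) (n + 1) := by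
        rw [← hψρ, ← hfg, map_mul]
        exact Ideal.mul_mem_right _ _ hr
      have hf1 := X_pow_dvd_constantCoeff hf
      rw [constantCoeff_polySeries, X_pow_dvd_evalXi_iff] at hf1
      obtain ⟨h, hh⟩ := hf1
      -- The reduction of the numerator modulo `t` is `q ^ (n + 1) * h`, so `f = q ^ (n + 1) * h + t
      -- * f'`. The first term is visibly in `I ^ (n + 1)`; induction applies to the second, where a
      -- factor `t` lowers the total degree by one.
      obtain ⟨f', hf'⟩ := C_X_dvd_of_map_constantCoeff_eq_zero
        (f := f - (q.map PowerSeries.C) ^ (n + 1) * h.map PowerSeries.C) (by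
          have hid : (PowerSeries.constantCoeff (R := k)).comp PowerSeries.C = RingHom.id k := by
            ext; simp
          rw [Polynomial.map_sub, Polynomial.map_mul, Polynomial.map_pow, Polynomial.map_map,
            Polynomial.map_map, hid, Polynomial.map_id, Polynomial.map_id, hh, sub_self])
      have hr1 : r = ρ (q.map PowerSeries.C) ^ (n + 1) * (ρ (h.map PowerSeries.C) * g') +
          ρ (C PowerSeries.X) * (ρ f' * g') := by
        have h1 := congrArg ρ hf'
        rw [map_sub, map_mul, map_pow, map_mul, ← hfg] at h1
        linear_combination g' * h1 - r * hg'
      have hq1 : ρ (q.map PowerSeries.C) ^ (n + 1) * (ρ (h.map PowerSeries.C) * g') ∈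
          I ^ (n + 1) := Ideal.mul_mem_right _ _ (Ideal.pow_mem_pow hqI _)
      have hs : ρ f' * g' ∈ I ^ n := by
        apply ih
        rw [← X_mul_mem_totalDegreeIdeal_iff, ← hψt, ← map_mul, ← sub_eq_of_eq_add' hr1, map_sub]
        exact sub_mem hr (totalDegreeIdeal_one_pow_le (n + 1)
          ((Ideal.le_comap_pow ψ _) (Ideal.pow_right_mono hle _ hq1)))
      rw [hr1, pow_succ']
      refine add_mem ?_ (Ideal.mul_mem_mul htI hs)
      rwa [pow_succ'] at hq1
  refine isCompletionIn_of_filtration I φ (doubleSeries q) hj (totalDegreeIdeal (ResField q))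
    (fun n s hs i j hij => hs i j (by omega)) ?_ ?_ hφ ?_ ?_
  · intro s hs
    ext i j
    simpa using hs (i + j + 1) i j (by omega)
  · intro s hs
    refine ⟨PowerSeries.mk fun i => PowerSeries.mk fun j =>
      PowerSeries.coeff j (PowerSeries.coeff i (s (i + j + 1))), fun n i j hij => ?_⟩
    rw [map_sub, map_sub, PowerSeries.coeff_mk, PowerSeries.coeff_mk, sub_eq_zero]
    replace hij : i + j + 1 ≤ n := hij
    induction n, hij using Nat.le_induction with
    | base => rfl
    | succ n hn ih =>
      have := hs n i j (by omega)
      rw [map_sub, map_sub, sub_eq_zero] at this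
      rw [ih, this]
  · intro n r s hs
    rw [← hψ] at hs
    rw [hj hs]
    refine ⟨hge n r, fun hr => totalDegreeIdeal_one_pow_le n ?_⟩
    exact Ideal.le_comap_pow ψ _ (Ideal.pow_right_mono hle _ hr)
  · intro n
    induction n with
    | zero => exact fun s => ⟨0, 0, by simp, fun i j h => absurd h (Nat.not_lt_zero _)⟩
    | succ n ih =>
      intro s
      obtain ⟨s₁, hs₁⟩ := powerSeries_eq_C_add_X_mul s
      obtain ⟨r₁, s', h4, h5⟩ := ih s₁
      obtain ⟨p, hp⟩ := exists_X_pow_dvd_sub_evalXi q (n + 1) (PowerSeries.constantCoeff s)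
      refine ⟨ρ (p.map PowerSeries.C) + ρ (C PowerSeries.X) * r₁,
        PowerSeries.C (evalXi q p) + PowerSeries.X * s', ?_, ?_⟩
      · rw [← hψ, map_add ψ, map_mul ψ, hψρ, polySeries_map_C, hψt]
        rw [← hψ] at h4
        rw [hj h4]
      · have : s - (PowerSeries.C (evalXi q p) + PowerSeries.X * s') =
            PowerSeries.C (PowerSeries.constantCoeff s - evalXi q p) +
              PowerSeries.X * (s₁ - s') := by
          rw [map_sub]
          linear_combination hs₁
        rw [this]
        exact add_mem (C_mem_totalDegreeIdeal hp) (X_mul_mem_totalDegreeIdeal_iff.2 h5)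

end RingP

/-! ### Derivations -/

theorem derivation_mem_closure {M : Type*} [Field M] (D : SelfDerivation M) {s : Set M}
    (h : ∀ x ∈ s, D x ∈ Subfield.closure s) {x : M} (hx : x ∈ Subfield.closure s) :
    D x ∈ Subfield.closure s := by
  induction hx using Subfield.closure_induction with
  | mem x hx => exact h x hx
  | one => simp
  | add x y _ _ hx hy => rw [map_add]; exact add_mem hx hy
  | neg x _ hx => rw [map_neg]; exact neg_mem hx
  | inv x hx hx' =>
    rw [Derivation.leibniz_inv, smul_eq_mul]
    exact mul_mem (neg_mem (pow_mem (inv_mem hx) 2)) hx'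
  | mul x y hx hy hx' hy' =>
    rw [Derivation.leibniz, smul_eq_mul, smul_eq_mul]
    exact add_mem (mul_mem hx hy') (mul_mem hy hx')

theorem selfDerivation_mul {R : Type*} [CommRing R] (D : SelfDerivation R) (x y : R) :
    D (x * y) = x * D y + y * D x :=
  D.leibniz x y

theorem selfDerivation_pow {R : Type*} [CommRing R] (D : SelfDerivation R) (x : R) (n : ℕ) :
    D (x ^ n) = n * x ^ (n - 1) * D x := by
  rw [Derivation.leibniz_pow, nsmul_eq_mul, smul_eq_mul, mul_assoc]

theorem selfDerivation_div {M : Type*} [Field M] (D : SelfDerivation M) (x y : M) :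
    D (x / y) = y⁻¹ ^ 2 * (y * D x - x * D y) :=
  D.leibniz_div x y

/-- The restriction of a derivation to a subfield that it maps to itself. -/
def restrictDerivation {M : Type*} [Field M] (D : SelfDerivation M) (S : Subfield M)
    (h : ∀ x ∈ S, D x ∈ S) : SelfDerivation S :=
  SelfDerivation.ofAddMonoidHom
    { toFun := fun x => ⟨D x, h x x.2⟩
      map_zero' := Subtype.ext (map_zero D)
      map_add' := fun x y => Subtype.ext (map_add D (x : M) y) }
    (fun x y => Subtype.ext (D.leibniz (x : M) y))

/-- The derivation of `K((w))` with respect to `w`. -/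
def laurentDerivation (K : Type*) [Field K] : SelfDerivation (LaurentSeries K) :=
  SelfDerivation.ofAddMonoidHom (LaurentSeries.derivative K).toAddMonoidHom laurent_leibniz

section

variable {K : Type*} [Field K]

theorem laurentDerivation_coeff (z : LaurentSeries K) (n : ℤ) :
    (laurentDerivation K z).coeff n = (n + 1 : ℤ) * z.coeff (n + 1) := by
  change (LaurentSeries.derivative K z).coeff n = _
  rw [LaurentSeries.derivative_apply, LaurentSeries.hasseDeriv_coeff]
  simp

theorem laurentDerivation_C (c : K) : laurentDerivation K (HahnSeries.C c) = 0 := by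
  ext n
  rw [laurentDerivation_coeff, HahnSeries.C_apply, HahnSeries.coeff_single]
  split_ifs with h
  · simp [h]
  · simp

theorem laurentDerivation_single_one : laurentDerivation K (HahnSeries.single (1 : ℤ) 1) = 1 := by
  ext n
  rw [laurentDerivation_coeff, HahnSeries.coeff_single, HahnSeries.coeff_one]
  by_cases h : n = 0
  · simp [h]
  · simp [h]

theorem exists_laurentDerivation_ofPowerSeries (s : PowerSeries K) :
    ∃ s', laurentDerivation K (HahnSeries.ofPowerSeries ℤ K s) = HahnSeries.ofPowerSeries ℤ K s' := by
  refine ⟨PowerSeries.mk fun n => ((n + 1 : ℤ) : K) * PowerSeries.coeff (n + 1) s, ?_⟩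
  ext n
  rw [laurentDerivation_coeff, PowerSeries.coeff_coe, PowerSeries.coeff_coe]
  rcases lt_or_ge n 0 with h | h
  · rw [if_pos h]
    split_ifs with h'
    · simp
    · obtain rfl : n = -1 := by omega
      simp
  · obtain ⟨n, rfl⟩ := Int.eq_ofNat_of_zero_le h
    rw [if_neg (by omega), if_neg (by omega), PowerSeries.coeff_mk]
    rfl

theorem partialDeriv_apply (a f : LaurentSeries (LaurentSeries K)) :
    partialDeriv a f = a * partialDeriv 1 f := by
  change a * _ = a * (1 * _)
  rw [one_mul]

theorem partialDeriv_one_coeff (f : LaurentSeries (LaurentSeries K)) (n : ℤ) :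
    (partialDeriv 1 f).coeff n = laurentDerivation K (f.coeff n) := by
  change (1 * f.map (LaurentSeries.derivative K)).coeff n = _
  rw [one_mul, HahnSeries.map_coeff]
  rfl

theorem partialDeriv_one_ofPowerSeries (f : PowerSeries (LaurentSeries K)) :
    partialDeriv 1 (HahnSeries.ofPowerSeries ℤ _ f) = HahnSeries.ofPowerSeries ℤ _
      (PowerSeries.mk fun n => laurentDerivation K (PowerSeries.coeff n f)) := by
  ext1
  funext n
  rw [partialDeriv_one_coeff, PowerSeries.coeff_coe, PowerSeries.coeff_coe]
  split_ifs
  · exact map_zero _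
  · rw [PowerSeries.coeff_mk]

theorem partialDeriv_one_C (c : LaurentSeries K) :
    partialDeriv 1 (HahnSeries.C c) = HahnSeries.C (laurentDerivation K c) := by
  ext1
  funext n
  rw [partialDeriv_one_coeff, HahnSeries.C_apply, HahnSeries.C_apply, HahnSeries.coeff_single,
    HahnSeries.coeff_single]
  split_ifs
  · rfl
  · exact map_zero _

end

/-! ### Restriction of `∂_a` to `F`, `F_P` and `F_U` -/

section Restriction

variable {k : Type*} [Field k]

theorem ddx_ofPoly (p : k[X]) : ddx (ofPoly p) = ofPoly (derivative p) := by
  rw [ddx, ofPoly, RatFunc.num_algebraMap, RatFunc.denom_algebraMap]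
  simp [ofPoly, derivative_map]

variable (q : k[X]) [Fact (Irreducible q)]

theorem laurentDerivation_mem_integers {z : LaurentSeries (ResField q)} (hz : z ∈ integers q) :
    laurentDerivation _ z ∈ integers q := by
  obtain ⟨s, rfl⟩ := hz
  obtain ⟨s', hs'⟩ := exists_laurentDerivation_ofPowerSeries s
  exact ⟨s', hs'.symm⟩

theorem ringPhat_eq : ringPhat q = (seriesHom (integers q)).range := by
  ext z
  rw [mem_range_seriesHom]
  constructor
  · rintro ⟨f, rfl⟩
    exact ⟨_, fun n => ⟨PowerSeries.coeff n f, (PowerSeries.coeff_map _ _ _).symm⟩, rfl⟩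
  · rintro ⟨f, hf, rfl⟩
    choose s hs using hf
    refine ⟨PowerSeries.mk s, ?_⟩
    rw [doubleSeries_apply]
    congr 1
    ext1 n
    rw [PowerSeries.coeff_map, PowerSeries.coeff_mk, hs]

theorem laurentDerivation_unif : laurentDerivation _ (unif q) = 1 :=
  laurentDerivation_single_one

variable [CharZero k]

theorem laurentDerivation_evalXiL_aux (p : k[X]) :
    laurentDerivation _ (evalXiL q p) =
      evalXiL q (derivative p) * laurentDerivation _ (xiL q) := by
  induction p using Polynomial.induction_on' with
  | add p p' h h' => rw [map_add, map_add, h, h', derivative_add, map_add, add_mul]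
  | monomial n c =>
    rw [derivative_monomial, ← C_mul_X_pow_eq_monomial, ← C_mul_X_pow_eq_monomial, map_mul,
      map_pow, evalXiL_X, evalXiL_C, selfDerivation_mul, selfDerivation_pow, baseHom,
      RingHom.comp_apply, laurentDerivation_C, map_mul, map_pow, evalXiL_X, C_mul, map_mul,
      evalXiL_C, baseHom, RingHom.comp_apply]
    rw [map_natCast, map_natCast]
    ring

/-- The chain rule applied to `q(ξ) = w`. This is the source of the factor `(∂q/∂x)⁻¹` in `β`. -/
theorem evalXiL_derivative_mul : evalXiL q (derivative q) * laurentDerivation _ (xiL q) = 1 := by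
  rw [← laurentDerivation_evalXiL_aux, evalXiL_self, laurentDerivation_unif]

theorem evalXiL_derivative_mul_laurentDerivation (p : k[X]) :
    evalXiL q (derivative q) * laurentDerivation _ (evalXiL q p) = evalXiL q (derivative p) := by
  rw [laurentDerivation_evalXiL_aux]
  linear_combination evalXiL q (derivative p) * evalXiL_derivative_mul q

/-- On `k(x)` the operator `q' ∂/∂q` is `∂/∂x`, and `(f / q ^ m)' = (f' q - m f q') / q ^ (m + 1)`
has numerator of degree at most `r * (m + 1)`. The factor `q'` is needed because its inverse may
have poles on `U`. -/
theorem mul_laurentDerivation_mem_coordRingU {z : LaurentSeries (ResField q)}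
    (hz : z ∈ coordRingU q) :
    evalXiL q (derivative q) * laurentDerivation _ z ∈ coordRingU q := by
  -- A positive exponent `m = l + 1` is requested so that the exponent `m - 1` in the power rule is
  -- not a truncated subtraction.
  obtain ⟨m, hm, f, hf, h⟩ := exists_evalXiL_of_mem q hz 1
  obtain ⟨l, rfl⟩ := Nat.exists_eq_add_of_le' hm
  have hr := natDegree_pos_of_fact q
  have hq' : (derivative q).natDegree + 1 ≤ q.natDegree := by
    have := natDegree_derivative_le q
    omega
  refine evalXiL_div_unif_mem q (f := derivative f * q - C ((l + 1 : ℕ) : k) * (f * derivative q))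
    (m := l + 1 + 1) ?_ ?_
  · rw [mul_add q.natDegree, mul_one]
    refine (natDegree_sub_le _ _).trans (max_le (natDegree_mul_le.trans ?_)
      ((natDegree_C_mul_le _ _).trans (natDegree_mul_le.trans ?_)))
    · have := natDegree_derivative_le f
      omega
    · omega
  · have h1 := congrArg (laurentDerivation _) h
    rw [selfDerivation_mul, selfDerivation_pow, laurentDerivation_unif] at h1
    have h2 := evalXiL_derivative_mul_laurentDerivation q f
    rw [← h1, Nat.add_sub_cancel] at h2
    rw [map_sub, map_mul, map_mul, map_mul, ← h, ← h2, evalXiL_self, evalXiL_C, map_natCast]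
    ring

variable {q} in
-- The field `F` is generated by `k((t))` and `x`, and a Laurent series over `k` is a power series
-- over `k` divided by a power of `t`. Only the image of `x` needs separate attention.
theorem fieldF_le_fractionField {S : Subring (LaurentSeries (ResField q))}
    (hb : ∀ c, baseHom q c ∈ S)
    (hξ : HahnSeries.C (xiL q) ∈ fractionField (seriesHom S).range) :
    fieldF q ≤ fractionField (seriesHom S).range := by
  have hmem : ∀ f, seriesHom S f ∈ fractionField (seriesHom S).range :=
    fun f => Subfield.subset_closure (RingHom.mem_range_self _ f)
  have hc : ∀ c, mapLaurent (baseHom q) c ∈ fractionField (seriesHom S).range := by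
    intro c
    obtain ⟨n, f, h⟩ := exists_pow_mul_eq_ofPowerSeries c
    have h1 := congrArg (mapLaurent (baseHom q)) h
    rw [map_mul, map_pow, mapLaurent_ofPowerSeries, mapLaurent_ofPowerSeries,
      PowerSeries.map_X] at h1
    have hX : HahnSeries.ofPowerSeries ℤ (LaurentSeries (ResField q)) PowerSeries.X ≠ 0 := by
      rw [Ne, map_eq_zero_iff _ HahnSeries.ofPowerSeries_injective]
      exact PowerSeries.X_ne_zero
    have hz : mapLaurent (baseHom q) c = HahnSeries.ofPowerSeries ℤ _ (PowerSeries.map (baseHom q) f) /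
        HahnSeries.ofPowerSeries ℤ _ PowerSeries.X ^ n := by
      rw [eq_div_iff (pow_ne_zero n hX), mul_comm, h1]
    rw [hz]
    refine div_mem (Subfield.subset_closure (mem_range_seriesHom.2 ⟨_, fun i => ?_, rfl⟩))
      (pow_mem (Subfield.subset_closure (mem_range_seriesHom.2 ⟨_, fun i => ?_, rfl⟩)) n)
    · rw [PowerSeries.coeff_map]
      exact hb _
    · rw [PowerSeries.coeff_X]
      split_ifs
      · exact one_mem S
      · exact zero_mem S
  have hp : ∀ p, embedPoly q p ∈ fractionField (seriesHom S).range := by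
    intro p
    rw [embedPoly, coe_eval₂RingHom, eval₂_eq_sum]
    exact sum_mem fun i _ => mul_mem (hc _) (pow_mem hξ i)
  rintro _ ⟨f, rfl⟩
  rw [embed, RatFunc.liftRingHom_apply]
  exact div_mem (hp _) (hp _)

omit [CharZero k] in
theorem C_mem_fractionField {S : Subring (LaurentSeries (ResField q))}
    {c : LaurentSeries (ResField q)} (hc : c ∈ S) :
    HahnSeries.C c ∈ fractionField (seriesHom S).range := by
  refine Subfield.subset_closure ⟨PowerSeries.C ⟨c, hc⟩, ?_⟩
  simp [seriesHom]

theorem fieldF_le_fieldP : fieldF q ≤ fieldP q := by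
  rw [fieldP, ringPhat_eq]
  refine fieldF_le_fractionField (fun c => ?_) (C_mem_fractionField q ?_)
  · rw [← evalXiL_C]; exact evalXiL_mem_integers q _
  · rw [← evalXiL_X]; exact evalXiL_mem_integers q _

theorem unif_inv_mem_coordRingU : (unif q)⁻¹ ∈ coordRingU q :=
  evalXiL_div_unif_mem q (f := 1) (m := 1) (by simp)
    (by rw [pow_one, inv_mul_cancel₀ (unif_ne_zero q), map_one])

theorem baseHom_mem_coordRingU (c : k) : baseHom q c ∈ coordRingU q :=
  Subring.subset_closure (Or.inl ⟨c, rfl⟩)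

/-- Although `x` has a pole at infinity, it is the quotient of `x q⁻¹` by `q⁻¹`, both regular on
`U`. -/
theorem fieldF_le_fieldU : fieldF q ≤ fieldU q := by
  refine fieldF_le_fractionField (S := coordRingU q) (baseHom_mem_coordRingU q) ?_
  have hw := unif_ne_zero q
  have h1 : xiL q * (unif q)⁻¹ ∈ coordRingU q := by
    refine evalXiL_div_unif_mem q (f := X) (m := 1) ?_ ?_
    · rw [natDegree_X, mul_one]
      exact natDegree_pos_of_fact q
    · rw [pow_one, inv_mul_cancel_right₀ hw, evalXiL_X]
  have h2 : (HahnSeries.C (xiL q) : FPcirc q) =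
      HahnSeries.C (xiL q * (unif q)⁻¹) / HahnSeries.C ((unif q)⁻¹) := by
    rw [← map_div₀, mul_div_cancel_right₀ _ (inv_ne_zero hw)]
  rw [h2]
  exact div_mem (C_mem_fractionField q h1) (C_mem_fractionField q (unif_inv_mem_coordRingU q))

omit [CharZero k] in
theorem partialDeriv_mem_fieldP {a f : FPcirc q} (ha : a ∈ fieldP q) (hf : f ∈ fieldP q) :
    partialDeriv a f ∈ fieldP q := by
  refine derivation_mem_closure _ (fun x hx => ?_) hf
  rw [partialDeriv_apply]
  refine mul_mem ha (Subfield.subset_closure ?_)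
  rw [SetLike.mem_coe, ringPhat_eq, mem_range_seriesHom] at hx ⊢
  obtain ⟨f, hf, rfl⟩ := hx
  refine ⟨_, fun n => ?_, (partialDeriv_one_ofPowerSeries f).symm⟩
  rw [PowerSeries.coeff_mk]
  exact laurentDerivation_mem_integers q (hf n)

theorem embed_ofPoly_mem_fieldU (p : k[X]) : HahnSeries.C (evalXiL q p) ∈ fieldU q :=
  fieldF_le_fieldU q ⟨ofPoly p, embed_ofPoly q p⟩

theorem evalXiL_derivative_ne_zero : evalXiL q (derivative q) ≠ 0 :=
  left_ne_zero_of_mul_eq_one (evalXiL_derivative_mul q)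

/-- It suffices to treat series over the coordinate ring. There `q' ∂/∂q` acts coefficientwise
inside the ring, and the extra factor `q'` can be divided out because it lies in `F`, hence in
`F_U`. -/
theorem partialDeriv_mem_fieldU {a f : FPcirc q} (ha : a ∈ fieldU q) (hf : f ∈ fieldU q) :
    partialDeriv a f ∈ fieldU q := by
  refine derivation_mem_closure _ (fun x hx => ?_) hf
  rw [partialDeriv_apply]
  refine mul_mem ha ?_
  obtain ⟨f, hf, rfl⟩ := mem_range_seriesHom.1 hx
  have h0 : (HahnSeries.C (evalXiL q (derivative q)) : FPcirc q) ≠ 0 := by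
    rw [_root_.map_ne_zero]; exact evalXiL_derivative_ne_zero q
  have hz : HahnSeries.C (evalXiL q (derivative q)) *
      partialDeriv 1 (HahnSeries.ofPowerSeries ℤ _ f) ∈ fieldU q := by
    refine Subfield.subset_closure ?_
    refine mem_range_seriesHom.2 ⟨PowerSeries.C (evalXiL q (derivative q)) *
      PowerSeries.mk fun n => laurentDerivation _ (PowerSeries.coeff n f), fun n => ?_, ?_⟩
    · rw [PowerSeries.coeff_C_mul, PowerSeries.coeff_mk]
      exact mul_laurentDerivation_mem_coordRingU q (hf n)
    · rw [map_mul, HahnSeries.ofPowerSeries_C, partialDeriv_one_ofPowerSeries]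
  have := div_mem hz (embed_ofPoly_mem_fieldU q (derivative q))
  rwa [mul_div_cancel_left₀ _ h0] at this

/-- Both sides are derivations along the embedding; they vanish on `k((t))`, and both send `x` to
`1` because `q'(ξ) ξ' = 1`. -/
theorem partialDeriv_one_embedPoly (p : (LaurentSeries k)[X]) :
    HahnSeries.C (evalXiL q (derivative q)) * partialDeriv 1 (embedPoly q p) =
      embedPoly q (derivative p) := by
  have hq : (HahnSeries.C (evalXiL q (derivative q)) : FPcirc q) *
      HahnSeries.C (laurentDerivation _ (xiL q)) = 1 := by
    rw [← map_mul, evalXiL_derivative_mul, map_one]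
  have hc : ∀ c, partialDeriv 1 (mapLaurent (baseHom q) c) = 0 := by
    intro c
    ext1
    funext n
    rw [partialDeriv_one_coeff]
    exact laurentDerivation_C _
  have hC : ∀ c, embedPoly q (C c) = mapLaurent (baseHom q) c := by
    intro c
    rw [embedPoly, coe_eval₂RingHom, eval₂_C]
  have hX : embedPoly q X = HahnSeries.C (xiL q) := by
    rw [embedPoly, coe_eval₂RingHom, eval₂_X]
  induction p using Polynomial.induction_on' with
  | add p p' h h' => rw [map_add, map_add, mul_add, h, h', derivative_add, map_add]
  | monomial n c =>
    rw [derivative_monomial, ← C_mul_X_pow_eq_monomial, ← C_mul_X_pow_eq_monomial, map_mul,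
      map_pow, hC, hX, selfDerivation_mul, selfDerivation_pow, hc, partialDeriv_one_C,
      map_mul, map_pow, hX, C_mul, map_mul, hC, C_eq_natCast, map_natCast]
    linear_combination (mapLaurent (baseHom q) c * (n * HahnSeries.C (xiL q) ^ (n - 1))) * hq

theorem embed_ddx (f : FunctionField k) :
    embed q (ddx f) = HahnSeries.C (evalXiL q (derivative q)) * partialDeriv 1 (embed q f) := by
  have h0 : embedPoly q f.denom ≠ 0 := by
    rw [Ne, map_eq_zero_iff _ (embedPoly_injective q)]
    exact f.denom_ne_zero
  have hf : embed q f = embedPoly q f.num / embedPoly q f.denom := by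
    rw [embed, RatFunc.liftRingHom_apply]
  rw [hf, ddx, map_div₀, embed_algebraMap, embed_algebraMap, selfDerivation_div, map_sub,
    map_mul, map_mul, map_pow, ← partialDeriv_one_embedPoly, ← partialDeriv_one_embedPoly]
  field_simp

theorem embed_mul_ddx (a f : FunctionField k) :
    embed q ((ddx (ofPoly q))⁻¹ * a * ddx f) = partialDeriv (embed q a) (embed q f) := by
  have h0 : (HahnSeries.C (evalXiL q (derivative q)) : FPcirc q) ≠ 0 := by
    rw [_root_.map_ne_zero]; exact evalXiL_derivative_ne_zero q
  rw [map_mul, map_mul, map_inv₀, ddx_ofPoly, embed_ddx, embed_ofPoly]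
  field_simp
  rw [← partialDeriv_apply]

theorem partialDeriv_mem_fieldF (a : FunctionField k) {f : FPcirc q} (hf : f ∈ fieldF q) :
    partialDeriv (embed q a) f ∈ fieldF q := by
  obtain ⟨f, rfl⟩ := hf
  exact ⟨_, embed_mul_ddx q a f⟩

end Restriction

/-! ### Factorization -/

/-- Recursive choice in which the condition at stage `n` involves all terms up to `n`. It drives
both the matrix factorization and the division of power series, where coefficients in `t` are found
one after another. -/
theorem exists_seq_of_update {α : Type*} [Nonempty α] (Q : ℕ → (ℕ → α) → Prop)
    (hloc : ∀ n s s', (∀ m ≤ n, s m = s' m) → Q n s → Q n s')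
    (hstep : ∀ n s, (∀ m < n, Q m s) → ∃ a, Q n (Function.update s n a)) :
    ∃ s, ∀ n, Q n s := by
  have hstep' : ∀ n s, ∃ a, (∀ m < n, Q m s) → Q n (Function.update s n a) := by
    intro n s
    by_cases h : ∀ m < n, Q m s
    · exact (hstep n s h).imp fun a ha _ => ha
    · exact ⟨Classical.arbitrary α, fun h' => absurd h' h⟩
  choose F hF using hstep'
  let σ : ℕ → ℕ → α := fun n => Nat.rec (fun _ => Classical.arbitrary α)
    (fun n s => Function.update s n (F n s)) n
  have hσ : ∀ n, σ (n + 1) = Function.update (σ n) n (F n (σ n)) := fun n => rfl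
  have hσm : ∀ n m, m < n → σ n m = σ (m + 1) m := by
    intro n m h
    replace h : m + 1 ≤ n := h
    induction n, h using Nat.le_induction with
    | base => rfl
    | succ n hn ih => rw [hσ, Function.update_of_ne (by omega), ih]
  have hQ : ∀ n, ∀ m < n, Q m (σ n) := by
    intro n
    induction n with
    | zero => exact fun m h => absurd h (Nat.not_lt_zero _)
    | succ n ih =>
      intro m hm
      rcases Nat.lt_succ_iff_lt_or_eq.1 hm with h | rfl
      · refine hloc m (σ n) _ (fun l hl => ?_) (ih m h)
        rw [hσ, Function.update_of_ne (by omega)]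
      · rw [hσ]
        exact hF _ _ ih
  exact ⟨fun n => σ (n + 1) n, fun n =>
    hloc n (σ (n + 1)) _ (fun m hm => hσm _ _ (Nat.lt_succ_of_le hm)) (hQ _ n n.lt_succ_self)⟩

/-- Since `A` is congruent to `1`, coefficient `n` of `A * C` is `Cₙ` plus an expression in earlier
coefficients of `C`. Splitting that expression as `u + v` and taking `Cₙ = -v` leaves `u`, so the
additive decomposition becomes a multiplicative one. -/
theorem exists_powerSeries_matrix_mul {L ι : Type*} [Field L] [Fintype ι] [DecidableEq ι]
    (U V : Subring L) (hUV : ∀ z : L, ∃ u ∈ U, ∃ v ∈ V, z = u + v)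
    (A : Matrix ι ι (PowerSeries L)) (hA : A.map PowerSeries.constantCoeff = 1) :
    ∃ C : Matrix ι ι (PowerSeries L), C.map PowerSeries.constantCoeff = 1 ∧
      (∀ i j n, PowerSeries.coeff n (C i j) ∈ V) ∧
      ∀ i j n, PowerSeries.coeff n ((A * C) i j) ∈ U := by
  obtain ⟨s, hs⟩ := exists_seq_of_update (α := Matrix ι ι L)
    (fun n s => (n = 0 → s 0 = 1) ∧ (∀ i j, s n i j ∈ V) ∧
      ∀ i j, ∑ l ∈ Finset.range (n + 1), ∑ m, PowerSeries.coeff (n - l) (A i m) * s l m j ∈ U)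
    (by
      rintro n s s' h ⟨h1, h2, h3⟩
      refine ⟨fun hn => ?_, fun i j => ?_, fun i j => ?_⟩
      · rw [← h 0 (Nat.zero_le _), h1 hn]
      · rw [← h n le_rfl]; exact h2 i j
      · convert h3 i j using 3 with l hl
        rw [h l (by have := Finset.mem_range.1 hl; omega)])
    (by
      intro n s _
      have hA' : ∀ X : Matrix ι ι L, ∀ i j,
          ∑ m, PowerSeries.coeff 0 (A i m) * X m j = X i j := by
        intro X i j
        have h : A.map PowerSeries.constantCoeff * X = X := by rw [hA, one_mul]
        have h' := congrFun (congrFun h i) j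
        rw [Matrix.mul_apply] at h'
        simpa only [PowerSeries.coeff_zero_eq_constantCoeff_apply, Matrix.map_apply] using h'
      have hsum : ∀ a i j, ∑ l ∈ Finset.range (n + 1), ∑ m,
          PowerSeries.coeff (n - l) (A i m) * Function.update s n a l m j =
          ∑ l ∈ Finset.range n, ∑ m, PowerSeries.coeff (n - l) (A i m) * s l m j + a i j := by
        intro a i j
        rw [Finset.sum_range_succ, Function.update_self, Nat.sub_self, hA']
        congr 1
        refine Finset.sum_congr rfl fun l hl => ?_
        rw [Function.update_of_ne (Finset.mem_range.1 hl).ne]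
      have hone : ∀ (S : Subring L) (i j : ι), (1 : Matrix ι ι L) i j ∈ S := by
        intro S i j
        rw [Matrix.one_apply]
        split_ifs
        · exact one_mem S
        · exact zero_mem S
      rcases Nat.eq_zero_or_pos n with rfl | hn
      · refine ⟨1, fun _ => Function.update_self .., ?_, ?_⟩
        · rw [Function.update_self]
          exact hone V
        · intro i j
          rw [hsum, Finset.range_zero, Finset.sum_empty, zero_add]
          exact hone U i j
      · choose u hu v hv huv using hUV
        -- The new coefficient cancels the `V`-part of the contribution of the earlier ones.
        refine ⟨Matrix.of fun i j => -v (∑ l ∈ Finset.range n, ∑ m,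
          PowerSeries.coeff (n - l) (A i m) * s l m j), fun h => absurd h hn.ne', ?_, ?_⟩
        · rw [Function.update_self]
          exact fun i j => neg_mem (hv _)
        · intro i j
          rw [hsum, Matrix.of_apply]
          conv in _ + _ => rw [huv (∑ l ∈ Finset.range n, ∑ m,
            PowerSeries.coeff (n - l) (A i m) * s l m j)]
          rw [← huv, ← sub_eq_add_neg, sub_eq_of_eq_add (huv _)]
          exact hu _)
  refine ⟨Matrix.of fun i j => PowerSeries.mk fun n => s n i j, ?_, ?_, ?_⟩
  · rw [← (hs 0).1 rfl]
    ext i j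
    simp [← PowerSeries.coeff_zero_eq_constantCoeff_apply]
  · intro i j n
    rw [Matrix.of_apply, PowerSeries.coeff_mk]
    exact (hs n).2.1 i j
  · intro i j n
    convert (hs n).2.2 i j using 1
    rw [Matrix.mul_apply, map_sum, Finset.sum_comm]
    refine Finset.sum_congr rfl fun m _ => ?_
    rw [mul_comm, PowerSeries.coeff_mul,
      Finset.Nat.sum_antidiagonal_eq_sum_range_succ
        (fun a b => PowerSeries.coeff a (Matrix.of (fun i j => PowerSeries.mk fun n => s n i j) m j) *
          PowerSeries.coeff b (A i m))]
    refine Finset.sum_congr rfl fun l _ => ?_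
    rw [Matrix.of_apply, PowerSeries.coeff_mk, mul_comm]

/-- A matrix with entries in a subfield and non-zero determinant, as an element of the general
linear group over the subfield. -/
theorem exists_map_subtype_eq {M ι : Type*} [Field M] [Fintype ι] [DecidableEq ι]
    (S : Subfield M) (A : Matrix ι ι M) (hA : ∀ i j, A i j ∈ S) (hdet : A.det ≠ 0) :
    ∃ B : GL ι S, (Matrix.GeneralLinearGroup.map S.subtype B : Matrix ι ι M) = A := by
  let B : Matrix ι ι S := Matrix.of fun i j => ⟨A i j, hA i j⟩
  have hB : S.subtype.mapMatrix B = A := by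
    ext i j; rfl
  refine ⟨Matrix.GeneralLinearGroup.mkOfDetNeZero B fun h => hdet ?_, ?_⟩
  · rw [← hB, ← RingHom.map_det, h, map_zero]
  · exact hB

theorem det_ne_zero_of_map_constantCoeff {L ι : Type*} [Field L] [Fintype ι] [DecidableEq ι]
    {A : Matrix ι ι (PowerSeries L)} (hA : A.map PowerSeries.constantCoeff = 1) :
    ((HahnSeries.ofPowerSeries ℤ L).mapMatrix A).det ≠ 0 := by
  rw [← RingHom.map_det, Ne, map_eq_zero_iff _ HahnSeries.ofPowerSeries_injective]
  intro h
  have h1 := RingHom.map_det (PowerSeries.constantCoeff (R := L)) A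
  rw [h, map_zero, RingHom.mapMatrix_apply, hA, Matrix.det_one] at h1
  exact zero_ne_one h1

section Factorization

variable {k : Type*} [Field k] (q : k[X]) [Fact (Irreducible q)]

theorem ofPowerSeries_mem_fieldP {f : PowerSeries (LaurentSeries (ResField q))}
    (hf : ∀ n, PowerSeries.coeff n f ∈ integers q) :
    HahnSeries.ofPowerSeries ℤ _ f ∈ fieldP q := by
  rw [fieldP, ringPhat_eq]
  exact Subfield.subset_closure (mem_range_seriesHom.2 ⟨f, hf, rfl⟩)

theorem t_mem_fieldP : HahnSeries.ofPowerSeries ℤ _ PowerSeries.X ∈ fieldP q := by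
  refine ofPowerSeries_mem_fieldP q fun n => ?_
  rw [PowerSeries.coeff_X]
  split_ifs
  · exact one_mem _
  · exact zero_mem _

theorem C_mem_fieldP (z : LaurentSeries (ResField q)) : HahnSeries.C z ∈ fieldP q := by
  obtain ⟨m, hm⟩ := exists_mul_unif_pow_mem_integers q z
  have hw := pow_ne_zero m (unif_ne_zero q)
  have hmem : unif q ^ m ∈ integers q :=
    pow_mem ((mem_integers_iff q).2 ⟨PowerSeries.X, ofPowerSeries_X_eq_unif q⟩) m
  have h : (HahnSeries.C z : FPcirc q) =
      HahnSeries.C (z * unif q ^ m) / HahnSeries.C (unif q ^ m) := by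
    rw [← map_div₀, mul_div_cancel_right₀ _ hw]
  rw [h, fieldP, ringPhat_eq]
  exact div_mem (C_mem_fractionField q hm) (C_mem_fractionField q hmem)

theorem ofPowerSeries_X_ne_zero {L : Type*} [Field L] :
    HahnSeries.ofPowerSeries ℤ L PowerSeries.X ≠ 0 := by
  rw [Ne, map_eq_zero_iff _ HahnSeries.ofPowerSeries_injective]
  exact PowerSeries.X_ne_zero

/-- Truncations in `t` have finitely many terms, with coefficients in `k'((q)) ⊆ F_P`; thus `F_P` is
`t`-adically dense. -/
theorem exists_mem_fieldP_sub_eq (z : FPcirc q) (N : ℕ) :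
    ∃ c ∈ fieldP q, ∃ f, z - c = HahnSeries.ofPowerSeries ℤ _ (PowerSeries.X ^ N * f) := by
  have key : ∀ (N : ℕ) (f : PowerSeries (LaurentSeries (ResField q))), ∃ c ∈ fieldP q, ∃ g,
      HahnSeries.ofPowerSeries ℤ _ f - c =
        HahnSeries.ofPowerSeries ℤ _ (PowerSeries.X ^ N * g) := by
    intro N
    induction N with
    | zero => exact fun f => ⟨0, zero_mem _, f, by rw [sub_zero, pow_zero, one_mul]⟩
    | succ N ih =>
      intro f
      obtain ⟨f', hf'⟩ := powerSeries_eq_C_add_X_mul f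
      obtain ⟨c, hc, g, hg⟩ := ih f'
      refine ⟨HahnSeries.C (PowerSeries.constantCoeff f) +
        HahnSeries.ofPowerSeries ℤ _ PowerSeries.X * c,
        add_mem (C_mem_fieldP q _) (mul_mem (t_mem_fieldP q) hc), g, ?_⟩
      have h := congrArg (HahnSeries.ofPowerSeries ℤ _) hf'
      rw [map_add, HahnSeries.ofPowerSeries_C, map_mul] at h
      rw [pow_succ', mul_assoc, map_mul, ← hg]
      linear_combination h
  obtain ⟨n, f, h⟩ := exists_pow_mul_eq_ofPowerSeries z
  obtain ⟨c, hc, g, hg⟩ := key (n + N) f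
  have hT := pow_ne_zero n (ofPowerSeries_X_ne_zero (L := LaurentSeries (ResField q)))
  refine ⟨c / HahnSeries.ofPowerSeries ℤ _ PowerSeries.X ^ n,
    div_mem hc (pow_mem (t_mem_fieldP q) n), g, mul_left_cancel₀ hT ?_⟩
  rw [mul_sub, h, mul_div_cancel₀ _ hT, hg, pow_add, mul_assoc, map_mul, map_pow]

/-- Take for `C` an approximation to `A⁻¹` over `F_P`. If it is precise beyond the order of the
poles of `A` in `t`, the error stays divisible by `t` after multiplication by `A`. -/
theorem exists_approximate_inverse {n : ℕ} (A : GL (Fin n) (FPcirc q)) :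
    ∃ C : Matrix (Fin n) (Fin n) (FPcirc q), (∀ i j, C i j ∈ fieldP q) ∧
      ∃ D : Matrix (Fin n) (Fin n) (PowerSeries (LaurentSeries (ResField q))),
        D.map PowerSeries.constantCoeff = 1 ∧
          (A : Matrix (Fin n) (Fin n) (FPcirc q)) * C =
            (HahnSeries.ofPowerSeries ℤ (LaurentSeries (ResField q))).mapMatrix D := by
  set τ := HahnSeries.ofPowerSeries ℤ (LaurentSeries (ResField q)) with hτ
  choose m F hF using fun i j =>
    exists_pow_mul_eq_ofPowerSeries ((A : Matrix (Fin n) (Fin n) (FPcirc q)) i j)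
  -- `N` bounds the pole orders in `t` of all entries of `A`; precision `N + 1` leaves one factor of
  -- `t` to spare.
  obtain ⟨N, hN⟩ : ∃ N, ∀ i j, m i j ≤ N :=
    ⟨Finset.univ.sup fun p : Fin n × Fin n => m p.1 p.2, fun i j =>
      Finset.le_sup (f := fun p : Fin n × Fin n => m p.1 p.2) (Finset.mem_univ (i, j))⟩
  choose c hc g hg using fun i j => exists_mem_fieldP_sub_eq q
    (((A⁻¹ : GL (Fin n) (FPcirc q)) : Matrix (Fin n) (Fin n) (FPcirc q)) i j) (N + 1)
  refine ⟨Matrix.of c, hc, 1 - Matrix.of fun i j =>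
    PowerSeries.X * ∑ l, PowerSeries.X ^ (N - m i l) * F i l * g l j, ?_, ?_⟩
  · ext i j
    rw [Matrix.map_apply, Matrix.sub_apply, map_sub, Matrix.of_apply, map_mul,
      PowerSeries.constantCoeff_X, zero_mul, sub_zero, Matrix.one_apply, Matrix.one_apply]
    split_ifs <;> simp
  · have h1 : (A : Matrix (Fin n) (Fin n) (FPcirc q)) *
        ((A⁻¹ : GL (Fin n) (FPcirc q)) : Matrix (Fin n) (Fin n) (FPcirc q)) = 1 := by
      rw [← Units.val_mul, mul_inv_cancel, Units.val_one]
    have h2 : (Matrix.of c : Matrix (Fin n) (Fin n) (FPcirc q)) =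
        ((A⁻¹ : GL (Fin n) (FPcirc q)) : Matrix (Fin n) (Fin n) (FPcirc q)) -
          Matrix.of fun i j => τ (PowerSeries.X ^ (N + 1) * g i j) := by
      ext1 i j
      rw [Matrix.sub_apply, Matrix.of_apply, Matrix.of_apply, ← hg, sub_sub_cancel]
    rw [h2, mul_sub, h1, map_sub, map_one]
    congr 1
    ext1 i j
    rw [Matrix.mul_apply, RingHom.mapMatrix_apply, Matrix.map_apply, Matrix.of_apply, map_mul,
      map_sum, Finset.mul_sum]
    refine Finset.sum_congr rfl fun l _ => ?_
    rw [Matrix.of_apply, map_mul, map_mul, map_mul, ← hF, map_pow, map_pow,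
      show N + 1 = 1 + (N - m i l) + m i l by have := hN i l; omega, pow_add, pow_add]
    ring

variable [CharZero k]

/-- With `C₀` the approximate inverse and `C₁` the correction, `A C₀ C₁` has entries in `F_U`. It is
congruent to `1` modulo `t`, so its determinant is nonzero and `C₀ C₁` is invertible as well. -/
theorem exists_factorization (n : ℕ) (A : GL (Fin n) (FPcirc q)) :
    ∃ (B : GL (Fin n) (fieldU q)) (C : GL (Fin n) (fieldP q)),
      A = Matrix.GeneralLinearGroup.map (fieldU q).subtype B *
        Matrix.GeneralLinearGroup.map (fieldP q).subtype C := by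
  set τ := HahnSeries.ofPowerSeries ℤ (LaurentSeries (ResField q)) with hτ
  obtain ⟨C₀, hC₀, D, hD, hAC⟩ := exists_approximate_inverse q A
  obtain ⟨C₁, hC₁, hC₁V, hU⟩ := exists_powerSeries_matrix_mul (coordRingU q) (integers q)
    (exists_add_of_coordRingU_integers q) D hD
  have hDC : (D * C₁).map PowerSeries.constantCoeff = 1 := by
    rw [Matrix.map_mul, hD, hC₁, mul_one]
  have hB := det_ne_zero_of_map_constantCoeff hDC
  have hABC : (A : Matrix (Fin n) (Fin n) (FPcirc q)) * (C₀ * τ.mapMatrix C₁) =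
      τ.mapMatrix (D * C₁) := by
    rw [← mul_assoc, hAC, map_mul]
  have hC : (C₀ * τ.mapMatrix C₁).det ≠ 0 := by
    intro h
    rw [← hABC, Matrix.det_mul, h, mul_zero] at hB
    exact hB rfl
  obtain ⟨B, hB'⟩ := exists_map_subtype_eq (fieldU q) _ (fun i j => by
    exact Subfield.subset_closure (mem_range_seriesHom.2 ⟨_, hU i j, rfl⟩)) hB
  obtain ⟨C, hC'⟩ := exists_map_subtype_eq (fieldP q) _ (fun i j => by
    rw [Matrix.mul_apply]
    exact sum_mem fun l _ => mul_mem (hC₀ i l) (ofPowerSeries_mem_fieldP q (hC₁V l j))) hC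
  refine ⟨B, C⁻¹, ?_⟩
  rw [map_inv, eq_mul_inv_iff_mul_eq]
  refine Units.ext ?_
  rw [Units.val_mul, hC', hB', hABC]

end Factorization

/-! ### Weierstrass division and preparation -/

section Division

variable {k L : Type*} [Field k] [Field L] (b : k →+* L) {S : Subring L}

theorem coeff_mul_mem {f g : PowerSeries L} (hf : ∀ n, PowerSeries.coeff n f ∈ S)
    (hg : ∀ n, PowerSeries.coeff n g ∈ S) (n : ℕ) : PowerSeries.coeff n (f * g) ∈ S := by
  rw [PowerSeries.coeff_mul]
  exact sum_mem fun p _ => mul_mem (hf _) (hg _)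

theorem coeff_C_mem {c : L} (hc : c ∈ S) (n : ℕ) :
    PowerSeries.coeff n (PowerSeries.C c) ∈ S := by
  rw [PowerSeries.coeff_C]
  split_ifs
  · exact hc
  · exact zero_mem S

theorem coeff_X_pow_mem (m n : ℕ) : PowerSeries.coeff n (PowerSeries.X ^ m : PowerSeries L) ∈ S := by
  rw [PowerSeries.coeff_X_pow]
  split_ifs
  · exact one_mem S
  · exact zero_mem S

/-- The `k`-subspace spanned by the finitely many elements `e i` of `S` is a complement of `g₀ S`
in `S`, in the sense that their sum is `S`. -/
def IsCofiniteAt (S : Subring L) (g₀ : L) {d : ℕ} (e : Fin d → L) : Prop :=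
  (∀ i, e i ∈ S) ∧ ∀ s ∈ S, ∃ h ∈ S, ∃ c : Fin d → k, s = h * g₀ + ∑ i, b (c i) * e i

/-- Generators of `S / g₀ S` over `k` lift to generators of `S[[t]] / (g)` over `k[[t]]`: quotient
and remainder are determined coefficient by coefficient, dividing by the constant term `g₀` at each
stage. -/
theorem exists_eq_mul_add_sum {d : ℕ} {e : Fin d → L} {g : PowerSeries L}
    (hg : ∀ n, PowerSeries.coeff n g ∈ S)
    (he : IsCofiniteAt b S (PowerSeries.constantCoeff g) e)
    {f : PowerSeries L} (hf : ∀ n, PowerSeries.coeff n f ∈ S) :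
    ∃ h : PowerSeries L, (∀ n, PowerSeries.coeff n h ∈ S) ∧ ∃ c : Fin d → PowerSeries k,
      f = h * g + ∑ i, PowerSeries.map b (c i) * PowerSeries.C (e i) := by
  obtain ⟨s, hs⟩ := exists_seq_of_update (α := L × (Fin d → k))
    (fun n s => (s n).1 ∈ S ∧ PowerSeries.coeff n f =
      ∑ l ∈ Finset.range (n + 1), (s l).1 * PowerSeries.coeff (n - l) g +
        ∑ i, b ((s n).2 i) * e i)
    (by
      rintro n s s' h ⟨h1, h2⟩
      refine ⟨by rw [← h n le_rfl]; exact h1, ?_⟩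
      rw [h2, h n le_rfl]
      congr 1
      refine Finset.sum_congr rfl fun l hl => ?_
      rw [h l (by have := Finset.mem_range.1 hl; omega)])
    (by
      intro n s hs
      obtain ⟨h, hh, c, hc⟩ := he.2 (PowerSeries.coeff n f -
        ∑ l ∈ Finset.range n, (s l).1 * PowerSeries.coeff (n - l) g)
        (sub_mem (hf n) (sum_mem fun l hl =>
          mul_mem (hs l (Finset.mem_range.1 hl)).1 (hg _)))
      refine ⟨(h, c), ?_⟩
      rw [Function.update_self]
      refine ⟨hh, ?_⟩
      rw [Finset.sum_range_succ, Function.update_self, Nat.sub_self,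
        PowerSeries.coeff_zero_eq_constantCoeff_apply, add_assoc, ← hc]
      rw [Finset.sum_congr rfl (g := fun l => (s l).1 * PowerSeries.coeff (n - l) g) fun l hl => by
        rw [Function.update_of_ne (Finset.mem_range.1 hl).ne]]
      ring)
  refine ⟨PowerSeries.mk fun n => (s n).1, fun n => ?_,
    fun i => PowerSeries.mk fun n => (s n).2 i, ?_⟩
  · rw [PowerSeries.coeff_mk]
    exact (hs n).1
  · ext n
    rw [(hs n).2, map_add, map_sum, PowerSeries.coeff_mul,
      Finset.Nat.sum_antidiagonal_eq_sum_range_succ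
        (fun i j => PowerSeries.coeff i (PowerSeries.mk fun n => (s n).1) *
          PowerSeries.coeff j g)]
    congr 1
    · simp only [PowerSeries.coeff_mk]
    · refine Finset.sum_congr rfl fun i _ => ?_
      rw [PowerSeries.coeff_mul_C, PowerSeries.coeff_map, PowerSeries.coeff_mk]

/-- The values of `∑ⱼ cⱼ yʲ`, where the coefficients `cⱼ` are power series over `k`. -/
def seriesEval {n : ℕ} (c : Fin n → PowerSeries k) (y : L) : PowerSeries L :=
  ∑ j, PowerSeries.map b (c j) * PowerSeries.C (y ^ (j : ℕ))

/-- The quotient by `g` is generated by `d` elements over `k[[t]]`, so the `d + 1` powers `1, y, …,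
y ^ d` satisfy a nontrivial relation modulo `g`. That relation is a multiple of `g` polynomial in
`y`, and it is nonzero because the powers of `y` are independent over `k`. -/
theorem exists_seriesEval_eq_mul {d : ℕ} {e : Fin d → L} {g : PowerSeries L}
    (hg : ∀ n, PowerSeries.coeff n g ∈ S)
    (he : IsCofiniteAt b S (PowerSeries.constantCoeff g) e) (hb : ∀ c, b c ∈ S)
    {y : L} (hy : y ∈ S)
    (hy' : ∀ (n : ℕ) (c : Fin n → k), ∑ j, b (c j) * y ^ (j : ℕ) = 0 → c = 0) :
    ∃ (n : ℕ) (c : Fin n → PowerSeries k), seriesEval b c y ≠ 0 ∧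
      ∃ h, (∀ n, PowerSeries.coeff n h ∈ S) ∧ seriesEval b c y = h * g := by
  choose h hh c hc using fun j : Fin (d + 1) =>
    exists_eq_mul_add_sum b hg he (f := PowerSeries.C (y ^ (j : ℕ)))
      (coeff_C_mem (pow_mem hy _))
  -- The remainders `c j` are `d + 1` vectors in a free module of rank `d` over `k[[t]]`, hence
  -- dependent.
  obtain ⟨a, ha, i₀, hi₀⟩ : ∃ a : Fin (d + 1) → PowerSeries k,
      ∑ j, a j • c j = 0 ∧ ∃ i, a i ≠ 0 := by
    rw [← Fintype.not_linearIndependent_iff]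
    intro hli
    have := hli.fintype_card_le_finrank
    simp at this
  refine ⟨d + 1, a, ?_, ∑ j, PowerSeries.map b (a j) * h j, ?_, ?_⟩
  · intro h0
    apply hi₀
    ext n
    have h1 := hy' (d + 1) (fun j => PowerSeries.coeff n (a j)) (by
      rw [← map_zero (PowerSeries.coeff (R := L) n), ← h0, seriesEval, map_sum]
      refine Finset.sum_congr rfl fun j _ => ?_
      rw [PowerSeries.coeff_mul_C, PowerSeries.coeff_map])
    rw [map_zero]
    exact congrFun h1 i₀
  · intro n
    rw [map_sum]
    refine sum_mem fun j _ => coeff_mul_mem (fun m => ?_) (hh j) n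
    rw [PowerSeries.coeff_map]
    exact hb _
  · have h2 : ∀ i, ∑ j, PowerSeries.map b (a j) * PowerSeries.map b (c j i) = 0 := by
      intro i
      have := congrArg (PowerSeries.map b) (congrFun ha i)
      rw [Finset.sum_apply, map_sum, Pi.zero_apply, map_zero] at this
      rw [← this]
      refine Finset.sum_congr rfl fun j _ => ?_
      rw [Pi.smul_apply, smul_eq_mul, map_mul]
    have h3 : ∑ j, PowerSeries.map b (a j) *
        ∑ i, PowerSeries.map b (c j i) * PowerSeries.C (e i) = 0 := by
      simp only [Finset.mul_sum]
      rw [Finset.sum_comm]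
      refine Finset.sum_eq_zero fun i _ => ?_
      rw [← zero_mul (PowerSeries.C (e i)), ← h2 i, Finset.sum_mul]
      exact Finset.sum_congr rfl fun j _ => by ring
    rw [seriesEval, Finset.sum_mul]
    calc _ = ∑ j, (PowerSeries.map b (a j) * h j * g + PowerSeries.map b (a j) *
        ∑ i, PowerSeries.map b (c j i) * PowerSeries.C (e i)) :=
          Finset.sum_congr rfl fun j _ => by rw [hc j]; ring
      _ = _ := by rw [Finset.sum_add_distrib, h3, add_zero]

theorem exists_eq_X_pow_mul {g : PowerSeries L} (hg : g ≠ 0) :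
    ∃ (n : ℕ) (g' : PowerSeries L), g = PowerSeries.X ^ n * g' ∧
      PowerSeries.constantCoeff g' ≠ 0 :=
  ⟨g.order.toNat, g.divXPowOrder, PowerSeries.X_pow_order_mul_divXPowOrder.symm, by
    rw [← isUnit_iff_ne_zero, ← PowerSeries.isUnit_iff_constantCoeff]
    exact PowerSeries.isUnit_divided_by_X_pow_order hg⟩

/-- After a power of `t` is removed, a denominator has nonzero constant term and divides a
polynomial in `y` over `k[[t]]`. This gives the special denominators used in the intersection, with
`y = q` for `F_P` and `y = q⁻¹` for `F_U`. -/
theorem exists_mul_seriesEval_eq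
    (hS : ∀ g₀ ∈ S, g₀ ≠ 0 → ∃ (d : ℕ) (e : Fin d → L), IsCofiniteAt b S g₀ e)
    (hb : ∀ c, b c ∈ S) {y : L} (hy : y ∈ S)
    (hy' : ∀ (n : ℕ) (c : Fin n → k), ∑ j, b (c j) * y ^ (j : ℕ) = 0 → c = 0)
    {z : LaurentSeries L} (hz : z ∈ fractionField (seriesHom S).range) :
    ∃ (m n : ℕ) (c : Fin n → PowerSeries k) (f : PowerSeries L), seriesEval b c y ≠ 0 ∧
      (∀ n, PowerSeries.coeff n f ∈ S) ∧
      z * HahnSeries.ofPowerSeries ℤ L (PowerSeries.X ^ m * seriesEval b c y) =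
        HahnSeries.ofPowerSeries ℤ L f := by
  rw [fractionField, Subfield.mem_closure_iff, Subring.closure_eq] at hz
  obtain ⟨z₁, hz₁, z₂, hz₂, rfl⟩ := hz
  by_cases h0 : z₂ = 0
  -- Division by zero gives `z = 0`, for which the constant polynomial `1` serves as denominator.
  · refine ⟨0, 1, fun _ => 1, 0, ?_, fun n => ?_, ?_⟩
    · simp [seriesEval]
    · simp
    · simp [h0]
  obtain ⟨f, hf, rfl⟩ := mem_range_seriesHom.1 hz₁
  obtain ⟨g, hg, rfl⟩ := mem_range_seriesHom.1 hz₂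
  obtain ⟨m, g', rfl, hg'⟩ := exists_eq_X_pow_mul (g := g) (fun h => h0 (by rw [h, map_zero]))
  have hg'S : ∀ n, PowerSeries.coeff n g' ∈ S := by
    intro n
    rw [← PowerSeries.coeff_X_pow_mul g' m n]
    exact hg _
  obtain ⟨d, e, he⟩ := hS _ (by
    rw [← PowerSeries.coeff_zero_eq_constantCoeff_apply]; exact hg'S 0) hg'
  obtain ⟨n, c, hc, h, hh, hch⟩ := exists_seriesEval_eq_mul b hg'S he hb hy hy'
  refine ⟨m, n, c, f * h, hc, coeff_mul_mem hf hh, ?_⟩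
  rw [hch, show PowerSeries.X ^ m * (h * g') = (PowerSeries.X ^ m * g') * h by ring,
    map_mul (HahnSeries.ofPowerSeries ℤ L) _ h,
    ← mul_assoc, div_mul_cancel₀ _ h0, map_mul]

/-- Two descriptions of `z`, with denominators, by series in `w` and by series in `w⁻¹` are brought
over a common denominator. -/
theorem mul_common_denominator {z : LaurentSeries L} {f g Q₁ Q₂ : PowerSeries L} {m m' : ℕ}
    (h₁ : z * HahnSeries.ofPowerSeries ℤ L (PowerSeries.X ^ m * Q₁) =
      HahnSeries.ofPowerSeries ℤ L f)
    (h₂ : z * HahnSeries.ofPowerSeries ℤ L (PowerSeries.X ^ m' * Q₂) =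
      HahnSeries.ofPowerSeries ℤ L g) {w : L} (hw : w ≠ 0) (n n' : ℕ) :
    z * HahnSeries.ofPowerSeries ℤ L
        (PowerSeries.X ^ m * Q₁ * (PowerSeries.X ^ m' * (Q₂ * PowerSeries.C (w ^ n')))) =
      HahnSeries.ofPowerSeries ℤ L
        (f * (PowerSeries.X ^ m' * (Q₂ * PowerSeries.C (w ^ n')))) ∧
    f * (PowerSeries.X ^ m' * (Q₂ * PowerSeries.C (w ^ n'))) =
      g * (PowerSeries.X ^ m * (Q₁ * PowerSeries.C (w⁻¹ ^ n))) * PowerSeries.C (w ^ (n + n')) := by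
  have hmul : ∀ {u v : PowerSeries L},
      z * HahnSeries.ofPowerSeries ℤ L u = HahnSeries.ofPowerSeries ℤ L v →
      ∀ r, z * HahnSeries.ofPowerSeries ℤ L (u * r) = HahnSeries.ofPowerSeries ℤ L (v * r) := by
    intro u v h r
    rw [map_mul, ← mul_assoc, h, map_mul]
  refine ⟨hmul h₁ _, HahnSeries.ofPowerSeries_injective (Γ := ℤ) ?_⟩
  have hC : PowerSeries.C (w⁻¹ ^ n) * PowerSeries.C (w ^ (n + n')) = PowerSeries.C (w ^ n') := by
    rw [← map_mul, pow_add, ← mul_assoc, ← mul_pow, inv_mul_cancel₀ hw, one_pow, one_mul]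
  rw [← hmul h₁, mul_assoc g, ← hmul h₂]
  congr 2
  rw [← hC]
  ring

end Division

/-! ### The intersection of `F_P` and `F_U` -/

section Intersection

variable {k : Type*} [Field k] (q : k[X]) [Fact (Irreducible q)]

theorem eq_zero_of_sum_single_eq_zero (ε : ℤ) (hε : ε ≠ 0) (n : ℕ) (c : Fin n → k)
    (h : ∑ j, baseHom q (c j) *
      (HahnSeries.single ε 1 : LaurentSeries (ResField q)) ^ (j : ℕ) = 0) : c = 0 := by
  ext i
  have h1 := congrArg (fun z : LaurentSeries (ResField q) => z.coeff ((i : ℕ) • ε)) h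
  simp only [HahnSeries.coeff_sum, HahnSeries.coeff_zero] at h1
  rw [Finset.sum_eq_single i] at h1
  · rw [HahnSeries.single_pow, baseHom, RingHom.comp_apply, HahnSeries.C_mul_eq_smul,
      HahnSeries.coeff_smul] at h1
    simpa using h1
  · intro j _ hj
    rw [HahnSeries.single_pow, baseHom, RingHom.comp_apply, HahnSeries.C_mul_eq_smul,
      HahnSeries.coeff_smul, HahnSeries.coeff_single_of_ne, smul_zero]
    simpa [hε, Fin.ext_iff] using hj.symm
  · simp

theorem seriesEval_mul_C_eq {n : ℕ} (c : Fin n → PowerSeries k) :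
    seriesEval (baseHom q) c (unif q)⁻¹ * PowerSeries.C (unif q ^ n) =
      ∑ j, PowerSeries.map (baseHom q) (c j) * PowerSeries.C (unif q ^ (n - j : ℕ)) := by
  rw [seriesEval, Finset.sum_mul]
  refine Finset.sum_congr rfl fun j _ => ?_
  rw [mul_assoc, ← map_mul, inv_pow, pow_sub₀ _ (unif_ne_zero q) j.2.le, mul_comm (_ ^ n)]

theorem seriesEval_mul_C_inv_eq {n : ℕ} (c : Fin n → PowerSeries k) :
    seriesEval (baseHom q) c (unif q) * PowerSeries.C ((unif q)⁻¹ ^ n) =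
      ∑ j, PowerSeries.map (baseHom q) (c j) * PowerSeries.C ((unif q)⁻¹ ^ (n - j : ℕ)) := by
  rw [seriesEval, Finset.sum_mul]
  refine Finset.sum_congr rfl fun j _ => ?_
  rw [mul_assoc, ← map_mul, pow_sub₀ _ (inv_ne_zero (unif_ne_zero q)) j.2.le, ← inv_pow, inv_inv,
    mul_comm (_ ^ n)]

theorem coeff_sum_map_mem {S : Subring (LaurentSeries (ResField q))} (hb : ∀ c, baseHom q c ∈ S)
    {n : ℕ} (c : Fin n → PowerSeries k) {e : Fin n → LaurentSeries (ResField q)}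
    (he : ∀ j, e j ∈ S) (m : ℕ) :
    PowerSeries.coeff m (∑ j, PowerSeries.map (baseHom q) (c j) * PowerSeries.C (e j)) ∈ S := by
  rw [map_sum]
  refine sum_mem fun j _ => ?_
  rw [PowerSeries.coeff_mul_C, PowerSeries.coeff_map]
  exact mul_mem (hb _) (he j)

variable [CharZero k]

theorem evalXiL_eq_sum {p : k[X]} {d : ℕ} (hp : p.natDegree < d) :
    evalXiL q p = ∑ i : Fin d, baseHom q (p.coeff i) * xiL q ^ (i : ℕ) := by
  rw [evalXiL, coe_eval₂RingHom, eval₂_eq_sum_range' _ hp,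
    Fin.sum_univ_eq_sum_range (fun i => baseHom q (p.coeff i) * xiL q ^ i)]

/-- Up to a unit `g₀` is `q ^ n`, and modulo `q ^ n` every series is a polynomial in `x` of degree
less than `r * n`. -/
theorem exists_isCofiniteAt_integers {g₀ : LaurentSeries (ResField q)} (hg : g₀ ∈ integers q)
    (h0 : g₀ ≠ 0) :
    ∃ (d : ℕ) (e : Fin d → LaurentSeries (ResField q)),
      IsCofiniteAt (baseHom q) (integers q) g₀ e := by
  obtain ⟨g, rfl⟩ := hg
  obtain ⟨n, g', rfl, hg'⟩ := exists_eq_X_pow_mul (g := g) (fun h => h0 (by rw [h, map_zero]))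
  -- One generator more than necessary, because `natDegree` of the zero polynomial is `0` and strict
  -- inequality would fail for `n = 0`.
  refine ⟨q.natDegree * n + 1, fun i => xiL q ^ (i : ℕ), fun i => ?_, ?_⟩
  · rw [← evalXiL_X]
    exact pow_mem (evalXiL_mem_integers q X) _
  · rintro _ ⟨s, rfl⟩
    obtain ⟨p, hp, s', hs'⟩ := exists_degree_lt_X_pow_dvd_sub_evalXi q n s
    refine ⟨_, ⟨s' * g'⁻¹, rfl⟩, fun i => p.coeff i, ?_⟩
    rw [← evalXiL_eq_sum q (Nat.lt_succ_of_le (natDegree_le_of_degree_le hp.le)), evalXiL_eq,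
      ← map_mul, ← map_add]
    congr 1
    have := PowerSeries.mul_inv_cancel g' hg'
    linear_combination hs' - PowerSeries.X ^ n * s' * this

/-- Write `g₀ = f / q ^ m` with `f` prime to `q`. Multiples of `g₀` can cancel the leading polar
term of any element whose denominator exponent exceeds `m`, so modulo `g₀` only fractions `p' / q ^
m` with `deg p' ≤ r * m` remain. -/
theorem exists_isCofiniteAt_coordRingU {g₀ : LaurentSeries (ResField q)}
    (hg : g₀ ∈ coordRingU q) (h0 : g₀ ≠ 0) :
    ∃ (d : ℕ) (e : Fin d → LaurentSeries (ResField q)),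
      IsCofiniteAt (baseHom q) (coordRingU q) g₀ e := by
  have hw := unif_ne_zero q
  have hq : Irreducible q := Fact.out
  -- The fraction is brought to lowest terms. The degree bound forces the cancelled power of `q` to
  -- be at most the exponent in the denominator.
  obtain ⟨m, f, hf, hfq, hgf⟩ : ∃ (m : ℕ) (f : k[X]), f.natDegree ≤ q.natDegree * m ∧ ¬ q ∣ f ∧
      g₀ * unif q ^ m = evalXiL q f := by
    obtain ⟨m, -, f, hf, h⟩ := exists_evalXiL_of_mem q hg 0
    have hf0 : f ≠ 0 := by
      rintro rfl
      rw [map_zero] at h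
      exact mul_ne_zero h0 (pow_ne_zero _ hw) h
    obtain ⟨j, f', hf', rfl⟩ := WfDvdMonoid.max_power_factor hf0 hq
    rw [natDegree_mul (pow_ne_zero _ hq.ne_zero) (right_ne_zero_of_mul hf0), natDegree_pow] at hf
    have hjm : j ≤ m := by
      have hr := natDegree_pos_of_fact q
      by_contra! hlt
      have : q.natDegree * m < j * q.natDegree := by
        rw [mul_comm]; exact Nat.mul_lt_mul_of_pos_right hlt hr
      omega
    obtain ⟨l, rfl⟩ := Nat.exists_eq_add_of_le hjm
    refine ⟨l, f', ?_, hf', ?_⟩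
    · rw [mul_add, mul_comm q.natDegree j] at hf
      omega
    · rw [map_mul, map_pow, evalXiL_self, pow_add] at h
      refine mul_left_cancel₀ (pow_ne_zero j hw) ?_
      rw [← h]; ring
  obtain ⟨α, β, hαβ⟩ : IsCoprime f q := ((hq.coprime_iff_not_dvd).2 hfq).symm
  refine ⟨q.natDegree * m + 1, fun i => xiL q ^ (i : ℕ) * (unif q ^ m)⁻¹, fun i => ?_, ?_⟩
  · refine evalXiL_div_unif_mem q (f := X ^ (i : ℕ)) (m := m) ?_ ?_
    · rw [natDegree_X_pow]
      exact Nat.le_of_lt_succ i.2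
    · rw [inv_mul_cancel_right₀ (pow_ne_zero _ hw), map_pow, evalXiL_X]
  · suffices H : ∀ (l : ℕ) (p : k[X]), p.natDegree ≤ q.natDegree * (m + l) →
        ∃ h ∈ coordRingU q, ∃ p' : k[X], p'.natDegree ≤ q.natDegree * m ∧
          evalXiL q p * (unif q ^ (m + l))⁻¹ = h * g₀ + evalXiL q p' * (unif q ^ m)⁻¹ by
      intro s hs
      obtain ⟨n, hn, p, hp, h⟩ := exists_evalXiL_of_mem q hs m
      obtain ⟨l, rfl⟩ := Nat.exists_eq_add_of_le hn
      obtain ⟨h', hh', p', hp', h''⟩ := H l p hp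
      refine ⟨h', hh', fun i => p'.coeff i, ?_⟩
      rw [← h, mul_inv_cancel_right₀ (pow_ne_zero _ hw)] at h''
      rw [h'', evalXiL_eq_sum q (Nat.lt_succ_of_le hp'), Finset.sum_mul]
      simp only [mul_assoc]
    intro l
    induction l with
    | zero => exact fun p hp => ⟨0, zero_mem _, p, hp, by simp⟩
    | succ l ih =>
      intro p hp
      have hc : (p * α % q).natDegree < q.natDegree :=
        natDegree_mod_lt _ (natDegree_pos_of_fact q).ne'
      -- With `α f ≡ 1` modulo `q`, the polynomial `c = p α % q` satisfies `c f ≡ p` modulo `q`.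
      -- Subtracting `(c / q ^ (l + 1)) g₀` therefore lowers the exponent of the denominator by one,
      -- and `deg c < r` preserves the degree bound.
      obtain ⟨p₁, hp₁⟩ : q ∣ p - (p * α % q) * f := by
        refine ⟨p * β + (p * α / q) * f, ?_⟩
        linear_combination (-p) * hαβ - f * EuclideanDomain.div_add_mod (p * α) q
      have hdeg : p₁.natDegree ≤ q.natDegree * (m + l) := by
        by_cases hp0 : p₁ = 0
        · simp [hp0]
        have h1 : (q * p₁).natDegree ≤ q.natDegree * (m + l) + q.natDegree := by
          rw [← hp₁]
          refine (natDegree_sub_le _ _).trans (max_le (hp.trans_eq (by ring)) ?_)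
          refine natDegree_mul_le.trans ?_
          rw [mul_add]
          omega
        rw [natDegree_mul hq.ne_zero hp0] at h1
        omega
      obtain ⟨h, hh, p', hp', h1⟩ := ih p₁ hdeg
      refine ⟨h + evalXiL q (p * α % q) * (unif q ^ (l + 1))⁻¹, add_mem hh ?_, p', hp', ?_⟩
      · refine evalXiL_div_unif_mem q (f := p * α % q) (m := l + 1) ?_
          (inv_mul_cancel_right₀ (pow_ne_zero _ hw) _)
        rw [mul_add]
        omega
      · have h2 := congrArg (evalXiL q) hp₁
        rw [map_sub, map_mul, map_mul, ← hgf, evalXiL_self] at h2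
        rw [add_mul, add_right_comm, ← h1, pow_add _ m, pow_add _ m]
        field_simp
        linear_combination unif q ^ l * h2

theorem ofPowerSeries_mul_mem_fieldF (c : PowerSeries k) {x : LaurentSeries (ResField q)}
    {p : k[X]} (hx : x = evalXiL q p) :
    HahnSeries.ofPowerSeries ℤ _ (PowerSeries.map (baseHom q) c * PowerSeries.C x) ∈ fieldF q := by
  refine ⟨constants k (HahnSeries.ofPowerSeries ℤ k c) * ofPoly p, ?_⟩
  rw [map_mul, embed_constants, mapLaurent_ofPowerSeries, embed_ofPoly, map_mul,
    HahnSeries.ofPowerSeries_C, hx]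

theorem t_mem_fieldF : HahnSeries.ofPowerSeries ℤ _ PowerSeries.X ∈ fieldF q :=
  ⟨_, embed_t q⟩

/-- The degree bound, uniform in the power of `t`, allows the series to be regrouped by powers of
`x` into a polynomial over `k[[t]]`. -/
theorem ofPowerSeries_mem_fieldF {f : PowerSeries (LaurentSeries (ResField q))} {N : ℕ}
    (hf : ∀ n, ∃ p : k[X], p.natDegree ≤ N ∧ PowerSeries.coeff n f = evalXiL q p) :
    HahnSeries.ofPowerSeries ℤ _ f ∈ fieldF q := by
  choose p hp hfp using hf
  have h : f = ∑ i : Fin (N + 1), PowerSeries.map (baseHom q)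
      (PowerSeries.mk fun n => (p n).coeff i) * PowerSeries.C (xiL q ^ (i : ℕ)) := by
    ext1 n
    rw [hfp, evalXiL_eq_sum q (Nat.lt_succ_of_le (hp n)), map_sum]
    refine Finset.sum_congr rfl fun i _ => ?_
    rw [PowerSeries.coeff_mul_C, PowerSeries.coeff_map, PowerSeries.coeff_mk]
  rw [h, map_sum]
  exact sum_mem fun i _ => ofPowerSeries_mul_mem_fieldF q _ (p := X ^ (i : ℕ))
    (by rw [map_pow, evalXiL_X])

/-- Put `z = G / R` with `R`, the product of the two special denominators and `q ^ n'`, in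
`k[[t]][x]`. The `F_P`-description makes the coefficients of `G` integral at `P`; the
`F_U`-description makes them `q ^ (n + n')` times functions regular on `U`. They are therefore
polynomials of degree at most `r * (n + n')`. -/
theorem fieldP_inf_fieldU : fieldP q ⊓ fieldU q = fieldF q := by
  refine le_antisymm ?_ (le_inf (fieldF_le_fieldP q) (fieldF_le_fieldU q))
  rintro z ⟨hzP, hzU⟩
  have hw := unif_ne_zero q
  have hbO : ∀ c, baseHom q c ∈ integers q := by
    intro c
    rw [← evalXiL_C]; exact evalXiL_mem_integers q _
  have hwO : unif q ∈ integers q := by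
    rw [← evalXiL_self]; exact evalXiL_mem_integers q _
  have hinv : (unif q)⁻¹ = HahnSeries.single (-1 : ℤ) 1 := by
    simp [unif]
  rw [SetLike.mem_coe, fieldP, ringPhat_eq] at hzP
  obtain ⟨m, n, c, f, hc, hf, hzf⟩ := exists_mul_seriesEval_eq (baseHom q)
    (fun _ h h' => exists_isCofiniteAt_integers q h h') hbO hwO
    (fun n c h => eq_zero_of_sum_single_eq_zero q 1 one_ne_zero n c h) hzP
  obtain ⟨m', n', c', g, hc', hg, hzg⟩ := exists_mul_seriesEval_eq (baseHom q)
    (S := coordRingU q)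
    (fun _ h h' => exists_isCofiniteAt_coordRingU q h h') (baseHom_mem_coordRingU q)
    (unif_inv_mem_coordRingU q)
    (fun n c h => eq_zero_of_sum_single_eq_zero q (-1) (by norm_num) n c (by rwa [hinv] at h)) hzU
  set Q₁ := seriesEval (baseHom q) c (unif q) with hQ₁
  set Q₂ := seriesEval (baseHom q) c' (unif q)⁻¹ with hQ₂
  set τ := HahnSeries.ofPowerSeries ℤ (LaurentSeries (ResField q)) with hτ
  have hτi : Function.Injective τ := HahnSeries.ofPowerSeries_injective
  -- a common denominator which lies in `F`
  set R := PowerSeries.X ^ m * Q₁ * (PowerSeries.X ^ m' * (Q₂ * PowerSeries.C (unif q ^ n')))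
    with hR
  set E := g * (PowerSeries.X ^ m * (Q₁ * PowerSeries.C ((unif q)⁻¹ ^ n))) with hE
  set G := f * (PowerSeries.X ^ m' * (Q₂ * PowerSeries.C (unif q ^ n'))) with hG
  obtain ⟨hG1, hG2⟩ : z * τ R = τ G ∧ G = E * PowerSeries.C (unif q ^ (n + n')) :=
    mul_common_denominator hzf hzg hw n n'
  have hGO : ∀ i, PowerSeries.coeff i G ∈ integers q := by
    rw [hG, hQ₂, seriesEval_mul_C_eq]
    exact coeff_mul_mem hf (coeff_mul_mem (coeff_X_pow_mem _)
      (coeff_sum_map_mem q hbO c' fun j => pow_mem hwO _))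
  have hEU : ∀ i, PowerSeries.coeff i E ∈ coordRingU q := by
    rw [hE, hQ₁, seriesEval_mul_C_inv_eq]
    exact coeff_mul_mem hg (coeff_mul_mem (coeff_X_pow_mem _)
      (coeff_sum_map_mem q (baseHom_mem_coordRingU q) c fun j =>
        pow_mem (unif_inv_mem_coordRingU q) _))
  have hGF : τ G ∈ fieldF q := by
    refine ofPowerSeries_mem_fieldF q (N := q.natDegree * (n + n')) fun i => ?_
    refine exists_evalXiL_of_mem_integers q (hGO i) (hEU i) ?_
    rw [hG2, PowerSeries.coeff_mul_C]
  have hRF : τ R ∈ fieldF q := by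
    have h1 : τ Q₁ ∈ fieldF q := by
      rw [hQ₁, seriesEval, map_sum]
      exact sum_mem fun j _ => ofPowerSeries_mul_mem_fieldF q _ (p := q ^ (j : ℕ))
        (by rw [map_pow, evalXiL_self])
    have h2 : τ (Q₂ * PowerSeries.C (unif q ^ n')) ∈ fieldF q := by
      rw [hQ₂, seriesEval_mul_C_eq, map_sum]
      exact sum_mem fun j _ => ofPowerSeries_mul_mem_fieldF q _ (p := q ^ (n' - j : ℕ))
        (by rw [map_pow, evalXiL_self])
    rw [hR, map_mul, map_mul, map_mul, map_pow, map_pow]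
    exact mul_mem (mul_mem (pow_mem (t_mem_fieldF q) m) h1)
      (mul_mem (pow_mem (t_mem_fieldF q) m') h2)
  have hR0 : τ R ≠ 0 := by
    rw [Ne, map_eq_zero_iff _ hτi]
    refine mul_ne_zero (mul_ne_zero (pow_ne_zero _ PowerSeries.X_ne_zero) hc)
      (mul_ne_zero (pow_ne_zero _ PowerSeries.X_ne_zero) (mul_ne_zero hc' ?_))
    rw [Ne, map_eq_zero_iff _ PowerSeries.C_injective]
    exact pow_ne_zero _ hw
  rw [eq_div_of_mul_eq hR0 hG1]
  exact div_mem hGF hRF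

theorem isDiamond : IsDiamond (fieldF q) (fieldP q) (fieldU q) where
  le_left := fieldF_le_fieldP q
  le_right := fieldF_le_fieldU q
  inf_eq := fieldP_inf_fieldU q
  factorization := exists_factorization q

end Intersection

end

end DiffPatching

/-! ### The main theorem -/

open DiffPatching Polynomial in
theorem mainTheorem4 {k : Type*} [Field k] [CharZero k] (q : k[X]) [Fact (Irreducible q)]
    (a : FunctionField k) (ha : a ≠ 0) :
    (IsCompletionIn (localizationIdeal (chart RatFunc.X) (fibrePrime (Ideal.span {q})))
        ((embed q).comp (Subring.subtype _)) (ringPhat q) ∧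
      IsCompletionIn (Ideal.span {ringUt q}) ((embed q).comp (ringU q).subtype) (ringUhat q) ∧
      IsCompletionIn (localizationIdeal (doubleSeries q) (Ideal.span {PowerSeries.X}))
        (Subring.subtype _) (ringPcirc q) ∧
      fractionField (ringPcirc q) = ⊤) ∧
    ∃ (d : SelfDerivation (fieldF q)) (dP : SelfDerivation (fieldP q))
      (dU : SelfDerivation (fieldU q)),
      (∀ f : fieldP q, (dP f : FPcirc q) = partialDeriv (embed q a) f) ∧
      (∀ f : fieldU q, (dU f : FPcirc q) = partialDeriv (embed q a) f) ∧
      (∀ f : fieldF q, (d f : FPcirc q) = partialDeriv (embed q a) f) ∧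
      (∀ f : FunctionField k, (d ((embed q).rangeRestrictField f) : FPcirc q) =
        embed q ((ddx (ofPoly q))⁻¹ * a * ddx f)) ∧
      IsDifferentialDiamond (fieldF q) (fieldP q) (fieldU q) d dP dU
        (partialDeriv (embed q a)) := by
  have haF : embed q a ∈ fieldF q := ⟨a, rfl⟩
  refine ⟨⟨isCompletionIn_ringPhat q, isCompletionIn_ringUhat q, isCompletionIn_ringPcirc q,
    fractionField_ringPcirc q⟩,
    restrictDerivation _ _ fun _ hf => partialDeriv_mem_fieldF q a hf,
    restrictDerivation _ _ fun _ hf => partialDeriv_mem_fieldP q (fieldF_le_fieldP q haF) hf,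
    restrictDerivation _ _ fun _ hf => partialDeriv_mem_fieldU q (fieldF_le_fieldU q haF) hf,
    fun _ => rfl, fun _ => rfl, fun _ => rfl, fun f => (embed_mul_ddx q a f).symm, ?_⟩
  exact
    { toIsDiamond := isDiamond q
      charZero := charZero_of_injective_ringHom
        ((embed q).rangeRestrictField.comp ((constants k).comp HahnSeries.C)).injective
      compat_left := fun _ => rfl
      compat_right := fun _ => rfl
      compat₁ := fun _ => rfl
      compat₂ := fun _ => rfl }
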